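/- Let $P$ be the transition matrix of an irreducible Markov chain $(X_n)_{n\ge 0}$ on a finite state space $\Sigma$, with stationary distribution $\pi$, and let $i\in\Sigma$, $\epsilon\in(0,1)$, $\alpha\in(0,1)$. Write $\mathbb P_j,\mathbb E_j$ for the law of the chain started at $X_0=j$, $T_i=\inf\{n\ge 1: X_n=i\}$, $H_i=\max_{j\in\Sigma}\mathbb E_j[T_i]$, $Z=(I-P+\mathbf 1\pi^T)^{-1}$ (which equals $\sum_{n\ge0}(P^n-\mathbf 1\pi^T)$ when the chain is aperiodic), and $Z_{\max}(i)=\max_{k\in\Sigma}|Z_{ki}|$. Consider the following truncated Monte Carlo scheme. Iterations are indexed by $t=1,2,3,\dots$, and $\theta^{(t)}=2^t$. In iteration $t$ one draws $N^{(t)}$ fresh independent sample paths of the chain started at $i$, where $$N^{(1)}=\left\lceil\frac{6(1+\epsilon)\ln(8/\alpha)}{\epsilon^2}\right\rceil,\qquad N^{(t+1)}=\left\lceil\frac{3(1+\epsilon)\,\theta^{(t+1)}\ln(4\theta^{(t+1)}/\alpha)}{\hat T_i^{(t)}\,\epsilon^2}\right\rceil ,$$ $\hat T_i^{(t)}$ is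 the average of $\min(T_i,\theta^{(t)})$ over the $N^{(t)}$ samples of iteration $t$, and $\hat p^{(t)}$ is the fraction of these samples with $T_i>\theta^{(t)}$. Put $\tilde\pi_i^{(t)}=(1-\hat p^{(t)})/\hat T_i^{(t)}$. The scheme is continued for all $t$, so that the statement covers the iterations performed under any stopping rule. Theorem. With probability greater than $1-\alpha$, simultaneously for all iterations $t\ge 1$ such that $\mathbb P_i(T_i>\theta^{(t)})<1/2$, one has $\tilde\pi_i^{(t)}>0$ and $$\left|\frac{\tilde\pi_i^{(t)}-\pi_i}{\tilde\pi_i^{(t)}}\right|\le\left(\frac{1+\epsilon}{1-\epsilon}\right)\left(\frac{\mathbb P_i(T_i>\theta^{(t)})}{1-\mathbb P_i(T_i>\theta^{(t)})}\right)\max(2Z_{\max}(i)-1,1)+\frac{2\epsilon}{1-\epsilon}$$ $$\le\frac{4(1+\epsilon)}{1-\epsilon}\,2^{-\theta^{(t)}/(2H_i)}\max(2Z_{\max}(i)-1,1)+\frac{2\epsilon}{1-\epsilon}.$$ -/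

import Mathlib

open MeasureTheory ProbabilityTheory
open scoped ENNReal

noncomputable section

namespace ReturnTimeMC

section Chain

variable {S : Type*} [Fintype S] [DecidableEq S]

/-- A stationary distribution of the transition matrix `P`. -/
def IsStationary (P : Matrix S S ℝ) (π : S → ℝ) : Prop :=
  π ∈ stdSimplex ℝ S ∧ Matrix.vecMul π P = π

/-- The fundamental matrix `Z = (I - P + 1 πᵀ)⁻¹`. For an irreducible chain with stationary
distribution `π` the inverted matrix is nonsingular, and, if the chain is aperiodic,
`Z = ∑ₜ (Pᵗ - 1 πᵀ)`. -/
def fundamentalMatrix (P : Matrix S S ℝ) (π : S → ℝ) : Matrix S S ℝ :=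
  (1 - P + Matrix.of fun _ k => π k)⁻¹

/-- `Z_max(i) = max_k |Z_{ki}|`. -/
def Zmax (P : Matrix S S ℝ) (π : S → ℝ) (i : S) : ℝ :=
  ⨆ k, |fundamentalMatrix P π k i|

variable [MeasurableSpace S] [MeasurableSingletonClass S]

/-- One step of the chain from `x`: the probability measure giving mass `P x y` to each `y`. -/
def stepMeasure (P : Matrix.rowStochastic ℝ S) (x : S) : Measure S :=
  ∑ y, ENNReal.ofReal ((P : Matrix S S ℝ) x y) • Measure.dirac y

instance (P : Matrix.rowStochastic ℝ S) (x : S) : IsProbabilityMeasure (stepMeasure P x) := by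
  constructor
  have h : ∀ y ∈ (Finset.univ : Finset S), 0 ≤ (P : Matrix S S ℝ) x y := fun y _ =>
    Matrix.nonneg_of_mem_rowStochastic P.2
  simp only [stepMeasure, Measure.coe_finsetSum, Finset.sum_apply, Measure.smul_apply,
    measure_univ, smul_eq_mul, mul_one]
  rw [← ENNReal.ofReal_sum_of_nonneg h, Matrix.sum_row_of_mem_rowStochastic P.2,
    ENNReal.ofReal_one]

/-- The transition kernel as a function of the history `(X₀, …, Xₙ)`: it depends on `Xₙ` only. -/
def stepKernel (P : Matrix.rowStochastic ℝ S) (n : ℕ) :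
    Kernel ((_ : Finset.Iic n) → S) S where
  toFun h := stepMeasure P (h ⟨n, Finset.mem_Iic.2 le_rfl⟩)
  measurable' := (measurable_of_finite (stepMeasure P)).comp (measurable_pi_apply _)

instance (P : Matrix.rowStochastic ℝ S) (n : ℕ) : IsMarkovKernel (stepKernel P n) :=
  ⟨fun _ => inferInstanceAs (IsProbabilityMeasure (stepMeasure P _))⟩

/-- The law on trajectories of the Markov chain with transition matrix `P` started at `X₀ = j`. -/
def chainLaw (P : Matrix.rowStochastic ℝ S) (j : S) : Measure (ℕ → S) :=
  Kernel.traj (X := fun _ => S) (stepKernel P) 0 (fun _ => j)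

/-- `T_i = inf {t ≥ 1 : x_t = i}` along the trajectory `x` (`⊤` if there is no such `t`). -/
def returnTime {S : Type*} (i : S) (x : ℕ → S) : ℕ∞ :=
  ⨅ (t : ℕ) (_ : 1 ≤ t ∧ x t = i), (t : ℕ∞)

/-- `P_i(T_i > θ)`. -/
def returnTail (P : Matrix.rowStochastic ℝ S) (i : S) (θ : ℕ) : ℝ :=
  (chainLaw P i).real {x | (θ : ℕ∞) < returnTime i x}

/-- `E_j[T_i]`. -/
def meanTime (P : Matrix.rowStochastic ℝ S) (j i : S) : ℝ≥0∞ :=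
  ∫⁻ x, (returnTime i x : ℝ≥0∞) ∂(chainLaw P j)

/-- The maximal hitting time `H_i = max_j E_j[T_i]` (finite for an irreducible finite chain). -/
def maxHittingTime (P : Matrix.rowStochastic ℝ S) (i : S) : ℝ :=
  (⨆ j, meanTime P j i).toReal

end Chain

section Algorithm

variable {S : Type*}

/-- `min(T_i, θ)` along the trajectory `x`. -/
def truncTime (i : S) (θ : ℕ) (x : ℕ → S) : ℕ :=
  (min (returnTime i x) (θ : ℕ∞)).toNat

/-- The average of `min(T_i, θ)` over the first `N` of the trajectories `s 0, s 1, …`. -/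
def meanTruncTime (i : S) (θ N : ℕ) (s : ℕ → ℕ → S) : ℝ :=
  (∑ k ∈ Finset.range N, (truncTime i θ (s k) : ℝ)) / N

open Classical in
/-- The fraction of truncated trajectories (those with `T_i > θ`) among the first `N` of the
trajectories `s 0, s 1, …`. -/
def truncFraction (i : S) (θ N : ℕ) (s : ℕ → ℕ → S) : ℝ :=
  (((Finset.range N).filter fun k => (θ : ℕ∞) < returnTime i (s k)).card : ℝ) / N

/-- The truncation length `θ⁽ᵗ⁾ = 2ᵗ` of iteration `t = 1, 2, …`. -/
def threshold (t : ℕ) : ℕ := 2 ^ t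

/-- The number `N⁽ᵗ⁾` of samples in iteration `t = 1, 2, …` (the value at `0` is unused), when
iteration `t` uses the trajectories `X t 0, …, X t (N⁽ᵗ⁾ - 1)`. -/
def numSamples (ε α : ℝ) (i : S) (X : ℕ → ℕ → ℕ → S) : ℕ → ℕ
  | 0 => 0
  | 1 => ⌈6 * (1 + ε) * Real.log (8 / α) / ε ^ 2⌉₊
  | t + 2 =>
      ⌈3 * (1 + ε) * (threshold (t + 2) : ℝ) * Real.log (4 * (threshold (t + 2) : ℝ) / α) /
        (meanTruncTime i (threshold (t + 1)) (numSamples ε α i X (t + 1)) (X (t + 1)) * ε ^ 2)⌉₊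

/-- `T̂_i⁽ᵗ⁾`: the average truncated return time in iteration `t`. -/
def THat (ε α : ℝ) (i : S) (X : ℕ → ℕ → ℕ → S) (t : ℕ) : ℝ :=
  meanTruncTime i (threshold t) (numSamples ε α i X t) (X t)

/-- `p̂⁽ᵗ⁾`: the fraction of samples truncated in iteration `t`. -/
def pHat (ε α : ℝ) (i : S) (X : ℕ → ℕ → ℕ → S) (t : ℕ) : ℝ :=
  truncFraction i (threshold t) (numSamples ε α i X t) (X t)

/-- The estimate `π̃_i⁽ᵗ⁾ = (1 - p̂⁽ᵗ⁾) / T̂_i⁽ᵗ⁾`. -/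
def piTilde (ε α : ℝ) (i : S) (X : ℕ → ℕ → ℕ → S) (t : ℕ) : ℝ :=
  (1 - pHat ε α i X t) / THat ε α i X t

end Algorithm

end ReturnTimeMC

end

/-! Write `p = P_i(T_i > θ)`, `τ = E_i[min(T_i, θ)]` and `h_k = E_k[T_i]`. The proof separates the
bias of `(1 - p)/τ` as an approximation of `π_i` from the sampling error.

Bias. All laws of `T_i` are read off powers of the taboo matrix. By the Markov property at time `θ`,
`h_i - τ = ∑_k (taboo^θ)_{ik} h_k`, and Kac's formula `π_i h_i = 1` turns this into `(1 - p) - π_i τ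
= ∑_k (taboo^θ)_{ik} (π_i h_k - 1)`. The weights sum to `p`. For `k ≠ i`, `π_i h_k = Z_ii - Z_ki`,
so every bracket is at most `max(2 Z_max - 1, 1)` in absolute value (`abs_bias_le`). The tail `p`
decays geometrically because avoiding `i` for `⌊2H⌋` steps has probability at most 1/2 from any
start (`avoid_le_two_mul_rpow`).

Sampling. `N⁽ᵗ⁾` is random but depends only on earlier iterations, so a Chernoff bound for fixed
size can be applied conditionally on it (`measure_inter_random_index_le`). If `T̂⁽ᵗ⁻¹⁾` is accurate,
it is at most `(1 + ε) τ⁽ᵗ⁾`, so `N⁽ᵗ⁾` is large enough for `T̂⁽ᵗ⁾` to fail with probability at most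
`α / (2 θ⁽ᵗ⁾)`. For `p̂⁽ᵗ⁾` the deterministic bound `T̂⁽ᵗ⁻¹⁾ ≤ θ⁽ᵗ⁻¹⁾` suffices, with an extra
factor `exp(-ε)`. Summed over `t` the failures cost `(1 + exp(-ε)) α / 2 < α`, which is where
strictness comes from (`exists_bad_set`). Outside the bad set `relative_error_le` combines both
errors. -/

noncomputable section

namespace ReturnTimeMC

/-! ### Taboo matrix and avoidance probabilities. -/

section Taboo

variable {S : Type*} [Fintype S] [DecidableEq S]

/-- The matrix `A` with its `i`-th column replaced by zero: the transitions avoiding `i`. -/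
def taboo (A : Matrix S S ℝ) (i : S) : Matrix S S ℝ :=
  Matrix.of fun j k => if k = i then 0 else A j k

/-- The probability, as a function of the starting point, of avoiding `i` for `n` steps. -/
def avoid (A : Matrix S S ℝ) (i : S) (n : ℕ) : S → ℝ :=
  Matrix.mulVec (taboo A i ^ n) 1

lemma taboo_pow_nonneg {A : Matrix S S ℝ} (hA : ∀ j k, 0 ≤ A j k) (i : S) (n : ℕ) (j k : S) :
    0 ≤ (taboo A i ^ n) j k := by
  induction n generalizing j k with
  | zero => rw [pow_zero, Matrix.one_apply]; split_ifs <;> norm_num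
  | succ n ih =>
    rw [pow_succ, Matrix.mul_apply]
    refine Finset.sum_nonneg fun l _ => mul_nonneg (ih j l) ?_
    simp only [taboo, Matrix.of_apply]
    split_ifs
    exacts [le_rfl, hA l k]

lemma avoid_nonneg {A : Matrix S S ℝ} (hA : ∀ j k, 0 ≤ A j k) (i : S) (n : ℕ) (j : S) :
    0 ≤ avoid A i n j := by
  simp only [avoid, Matrix.mulVec, dotProduct]
  exact Finset.sum_nonneg fun k _ => mul_nonneg (taboo_pow_nonneg hA i n j k) (by simp)

end Taboo

/-! ### Return times under the trajectory law. -/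

section ChainLaw

variable {S : Type*} [Fintype S] [DecidableEq S] [MeasurableSpace S] [MeasurableSingletonClass S]

instance (P : Matrix.rowStochastic ℝ S) (j : S) : IsProbabilityMeasure (chainLaw P j) := by
  unfold chainLaw; infer_instance

lemma lt_returnTime_iff {S : Type*} {i : S} {x : ℕ → S} {n : ℕ} :
    (n : ℕ∞) < returnTime i x ↔ ∀ m, 1 ≤ m → m ≤ n → x m ≠ i := by
  rw [← not_le, returnTime]
  constructor
  · intro h m h1 hm hx
    exact h ((iInf₂_le m ⟨h1, hx⟩).trans (by exact_mod_cast hm))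
  · intro h hle
    have h2 : ((n + 1 : ℕ) : ℕ∞) ≤ ⨅ (t : ℕ) (_ : 1 ≤ t ∧ x t = i), (t : ℕ∞) := by
      refine le_iInf₂ fun t ht => ?_
      have : n < t := by
        by_contra hc
        exact h t ht.1 (not_lt.1 hc) ht.2
      exact_mod_cast this
    have h3 := h2.trans hle
    norm_cast at h3
    omega

lemma measurableSet_lt_returnTime {S : Type*} [MeasurableSpace S] [MeasurableSingletonClass S]
    (i : S) (n : ℕ) :
    MeasurableSet {x : ℕ → S | (n : ℕ∞) < returnTime i x} := by
  simp only [lt_returnTime_iff]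
  have : {x : ℕ → S | ∀ m, 1 ≤ m → m ≤ n → x m ≠ i} =
      ⋂ m, ⋂ (_ : 1 ≤ m), ⋂ (_ : m ≤ n), (fun x => x m) ⁻¹' {i}ᶜ := by
    ext x; simp
  rw [this]
  exact MeasurableSet.iInter fun m => MeasurableSet.iInter fun _ => MeasurableSet.iInter fun _ =>
    measurable_pi_apply m (MeasurableSet.singleton i).compl

lemma measurableSet_apply_eq {S : Type*} [MeasurableSpace S] [MeasurableSingletonClass S]
    (n : ℕ) (k : S) : MeasurableSet {x : ℕ → S | x n = k} := by
  have h := measurable_pi_apply (X := fun _ : ℕ => S) n (MeasurableSet.singleton k)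
  convert h
  ext x
  simp

lemma stepMeasure_singleton (P : Matrix.rowStochastic ℝ S) (l k : S) :
    stepMeasure P l {k} = ENNReal.ofReal ((P : Matrix S S ℝ) l k) := by
  simp [stepMeasure, Set.indicator_apply]

/-- The Markov property: the law of the history up to time `n` and of the next state. -/
lemma chainLaw_history_next (P : Matrix.rowStochastic ℝ S) (j : S) (n : ℕ)
    {E : Set ((_ : Finset.Iic n) → S)} (hE : MeasurableSet E) (k : S) :
    chainLaw P j {x | Preorder.frestrictLe (π := fun _ => S) n x ∈ E ∧ x (n + 1) = k} =
      ∑ l, chainLaw P j {x | Preorder.frestrictLe (π := fun _ => S) n x ∈ E ∧ x n = l} *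
        ENNReal.ofReal ((P : Matrix S S ℝ) l k) := by
  have hk := Kernel.partialTraj_compProd_eq_map_traj (X := fun _ => S) (κ := stepKernel P)
    (Nat.zero_le n) (x₀ := fun _ => j)
  have h1 := DFunLike.congr_fun hk (E ×ˢ {k})
  rw [Measure.map_apply (by fun_prop) (hE.prod (MeasurableSet.singleton k)),
    Measure.compProd_apply_prod hE (MeasurableSet.singleton k),
    ← Kernel.traj_map_frestrictLe_apply,
    setLIntegral_map hE (Kernel.measurable_coe _ (MeasurableSet.singleton k)) (by fun_prop)] at h1
  have h2 : {x : ℕ → S | Preorder.frestrictLe (π := fun _ => S) n x ∈ E ∧ x (n + 1) = k} =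
      (fun x => (Preorder.frestrictLe (π := fun _ => S) n x, x (n + 1))) ⁻¹' (E ×ˢ {k}) := by
    ext x; simp
  have hms : ∀ l, MeasurableSet
      {x : ℕ → S | Preorder.frestrictLe (π := fun _ => S) n x ∈ E ∧ x n = l} := fun l =>
    ((Preorder.measurable_frestrictLe (X := fun _ => S) n) hE).inter
      (measurableSet_apply_eq n l)
  rw [chainLaw, h2, ← h1, ← lintegral_indicator ((Preorder.measurable_frestrictLe n) hE)]
  -- The kernel sees the history only through its last state, so the integrand is a finite
  -- combination of indicators.
  have h3 : ∀ x : ℕ → S, (Preorder.frestrictLe (π := fun _ => S) n ⁻¹' E).indicator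
      (fun x => stepKernel P n (Preorder.frestrictLe (π := fun _ => S) n x) {k}) x =
      ∑ l, {x : ℕ → S | Preorder.frestrictLe (π := fun _ => S) n x ∈ E ∧ x n = l}.indicator
        (fun _ => ENNReal.ofReal ((P : Matrix S S ℝ) l k)) x := by
    intro x
    by_cases hx : Preorder.frestrictLe (π := fun _ => S) n x ∈ E
    · rw [Set.indicator_of_mem (by exact hx), Finset.sum_eq_single (x n)]
      · rw [Set.indicator_of_mem (by exact ⟨hx, rfl⟩)]
        exact stepMeasure_singleton P (x n) k
      · intro l _ hl
        exact Set.indicator_of_notMem (fun h => hl h.2.symm) _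
      · simp
    · rw [Set.indicator_of_notMem (by exact hx)]
      exact (Finset.sum_eq_zero fun l _ => Set.indicator_of_notMem (fun h => hx h.1) _).symm
  simp_rw [h3]
  rw [lintegral_finsetSum _ fun l _ => measurable_const.indicator (hms l)]
  refine Finset.sum_congr rfl fun l _ => ?_
  rw [lintegral_indicator_const (hms l), mul_comm]

lemma chainLaw_zero (P : Matrix.rowStochastic ℝ S) (j k : S) :
    chainLaw P j {x | x 0 = k} = if j = k then 1 else 0 := by
  have h := Kernel.traj_map_frestrictLe_apply (X := fun _ => S) (κ := stepKernel P) 0 0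
    (fun _ => j)
  have hm : MeasurableSet {h : (_ : Finset.Iic 0) → S | h ⟨0, by simp⟩ = k} :=
    (Set.toFinite _).measurableSet
  have h1 := DFunLike.congr_fun h {h | h ⟨0, by simp⟩ = k}
  rw [Kernel.partialTraj_self, Kernel.id_apply, Measure.map_apply (by fun_prop) hm,
    Measure.dirac_apply' _ hm] at h1
  simpa [chainLaw, Set.indicator_apply] using h1

/-- Keeping track of the current state makes the tail obey a one-step recursion by the Markov
property; a step into `i` contributes nothing, which is the zero column of the taboo matrix. -/
lemma chainLaw_avoid_eq (P : Matrix.rowStochastic ℝ S) (i j : S) (n : ℕ) (k : S) :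
    chainLaw P j {x | (n : ℕ∞) < returnTime i x ∧ x n = k} =
      ENNReal.ofReal ((taboo (P : Matrix S S ℝ) i ^ n) j k) := by
  have hnn : ∀ l k, 0 ≤ (P : Matrix S S ℝ) l k := fun l k =>
    Matrix.nonneg_of_mem_rowStochastic P.2
  induction n generalizing k with
  | zero =>
    have h : {x : ℕ → S | ((0 : ℕ) : ℕ∞) < returnTime i x ∧ x 0 = k} = {x | x 0 = k} := by
      ext x
      simp only [lt_returnTime_iff, Set.mem_ofPred_eq, and_iff_right_iff_imp]
      intro _ m h1 h2
      omega
    rw [h, chainLaw_zero, pow_zero, Matrix.one_apply]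
    split_ifs <;> simp
  | succ n ih =>
    rw [pow_succ, Matrix.mul_apply]
    by_cases hk : k = i
    · have h : {x : ℕ → S | ((n + 1 : ℕ) : ℕ∞) < returnTime i x ∧ x (n + 1) = k} = ∅ := by
        ext x
        simp only [lt_returnTime_iff, Set.mem_ofPred_eq, Set.mem_empty_iff_false, iff_false]
        rintro ⟨h1, h2⟩
        exact h1 (n + 1) (by omega) le_rfl (h2.trans hk)
      rw [h]
      simp [taboo, hk]
    · set E : Set ((_ : Finset.Iic n) → S) :=
        {h | ∀ m : Finset.Iic n, 1 ≤ (m : ℕ) → h m ≠ i} with hE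
      have hEm : MeasurableSet E := (Set.toFinite _).measurableSet
      have hEi : ∀ x : ℕ → S, Preorder.frestrictLe (π := fun _ => S) n x ∈ E ↔
          (n : ℕ∞) < returnTime i x := by
        intro x
        rw [lt_returnTime_iff]
        constructor
        · intro h m h1 h2
          exact h ⟨m, Finset.mem_Iic.2 h2⟩ h1
        · rintro h ⟨m, hm⟩ h1
          exact h m h1 (Finset.mem_Iic.1 hm)
      have h : {x : ℕ → S | ((n + 1 : ℕ) : ℕ∞) < returnTime i x ∧ x (n + 1) = k} =
          {x | Preorder.frestrictLe (π := fun _ => S) n x ∈ E ∧ x (n + 1) = k} := by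
        ext x
        simp only [Set.mem_ofPred_eq, hEi, lt_returnTime_iff]
        constructor
        · rintro ⟨h1, h2⟩
          exact ⟨fun m a b => h1 m a (by omega), h2⟩
        · rintro ⟨h1, h2⟩
          refine ⟨fun m a b => ?_, h2⟩
          rcases Nat.lt_or_ge n m with hm | hm
          · obtain rfl : m = n + 1 := by omega
            rwa [h2]
          · exact h1 m a hm
      rw [h, chainLaw_history_next P j n hEm,
        ENNReal.ofReal_sum_of_nonneg fun l _ => mul_nonneg (taboo_pow_nonneg hnn i n j l)
          (by simpa [taboo, hk] using hnn l k)]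
      refine Finset.sum_congr rfl fun l _ => ?_
      simp only [hEi]
      rw [ih, ENNReal.ofReal_mul (taboo_pow_nonneg hnn i n j l)]
      simp [taboo, hk]

/-- The tail of the return time in terms of the taboo matrix. -/
lemma chainLaw_lt_returnTime (P : Matrix.rowStochastic ℝ S) (i j : S) (n : ℕ) :
    chainLaw P j {x | (n : ℕ∞) < returnTime i x} =
      ENNReal.ofReal (avoid (P : Matrix S S ℝ) i n j) := by
  have hnn : ∀ l k, 0 ≤ (P : Matrix S S ℝ) l k := fun l k =>
    Matrix.nonneg_of_mem_rowStochastic P.2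
  have h : {x : ℕ → S | (n : ℕ∞) < returnTime i x} =
      ⋃ k ∈ (Finset.univ : Finset S), {x | (n : ℕ∞) < returnTime i x ∧ x n = k} := by
    ext x; simp
  rw [h, measure_biUnion_finset]
  · simp_rw [chainLaw_avoid_eq]
    rw [← ENNReal.ofReal_sum_of_nonneg fun l _ => taboo_pow_nonneg hnn i n j l]
    simp [avoid, Matrix.mulVec, dotProduct]
  · intro k _ l _ hkl
    exact Set.disjoint_left.2 fun x hx hy => hkl (hx.2.symm.trans hy.2)
  · exact fun k _ => (measurableSet_lt_returnTime i n).inter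
      (measurableSet_apply_eq n k)

lemma returnTail_eq (P : Matrix.rowStochastic ℝ S) (i : S) (n : ℕ) :
    returnTail P i n = avoid (P : Matrix S S ℝ) i n i := by
  rw [returnTail, Measure.real, chainLaw_lt_returnTime, ENNReal.toReal_ofReal]
  exact avoid_nonneg (fun l k => Matrix.nonneg_of_mem_rowStochastic P.2) i n i

/-- Layer-cake formula, valid also at `⊤`; it turns means of `T_i` into sums of tails. -/
lemma toENNReal_eq_tsum_indicator (a : ℕ∞) :
    (a : ℝ≥0∞) = ∑' n : ℕ, if (n : ℕ∞) < a then (1 : ℝ≥0∞) else 0 := by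
  induction a using ENat.recTopCoe with
  | top => simp
  | coe a =>
    rw [tsum_eq_sum (s := Finset.range a)]
    · rw [Finset.sum_congr rfl (g := fun _ => (1 : ℝ≥0∞))]
      · simp
      · intro n hn
        rw [if_pos (by exact_mod_cast Finset.mem_range.1 hn)]
    · intro n hn
      rw [if_neg]
      intro h
      exact hn (Finset.mem_range.2 (by exact_mod_cast h))

lemma meanTime_eq_tsum (P : Matrix.rowStochastic ℝ S) (j i : S) :
    meanTime P j i = ∑' n, ENNReal.ofReal (avoid (P : Matrix S S ℝ) i n j) := by
  simp_rw [meanTime, toENNReal_eq_tsum_indicator]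
  rw [lintegral_tsum]
  · refine tsum_congr fun n => ?_
    rw [← chainLaw_lt_returnTime, ← lintegral_indicator_one (measurableSet_lt_returnTime i n)]
    refine lintegral_congr fun x => ?_
    simp [Set.indicator_apply]
  · intro n
    exact (Measurable.ite (measurableSet_lt_returnTime i n) measurable_const
      measurable_const).aemeasurable

end ChainLaw

/-! ### The truncated return time and its mean. -/

section TruncTime

variable {S : Type*}

open Classical in
lemma truncTime_eq_sum (i : S) (θ : ℕ) (x : ℕ → S) :
    truncTime i θ x =
      ∑ n ∈ Finset.range θ, if (n : ℕ∞) < returnTime i x then 1 else 0 := by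
  rw [truncTime]
  generalize returnTime i x = a
  induction a using ENat.recTopCoe with
  | top => simp
  | coe a =>
    have : (min (a : ℕ∞) (θ : ℕ∞)).toNat = min a θ := by
      rcases le_total a θ with h | h
      · rw [min_eq_left (by exact_mod_cast h), min_eq_left h, ENat.toNat_natCast]
      · rw [min_eq_right (by exact_mod_cast h), min_eq_right h, ENat.toNat_natCast]
    rw [this, Finset.sum_boole]
    simp only [Nat.cast_lt]
    rw [show (Finset.range θ).filter (fun n => n < a) = Finset.range (min a θ) by
      ext n; simp [and_comm]]
    simp

lemma one_le_truncTime (i : S) {θ : ℕ} (hθ : 1 ≤ θ) (x : ℕ → S) : 1 ≤ truncTime i θ x := by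
  classical
  rw [truncTime_eq_sum]
  refine le_trans ?_ (Finset.single_le_sum (fun _ _ => Nat.zero_le _)
    (Finset.mem_range.2 (Nat.lt_of_lt_of_le Nat.zero_lt_one hθ)))
  rw [if_pos]
  rw [lt_returnTime_iff]
  intro m h1 h2
  omega

lemma truncTime_le (i : S) (θ : ℕ) (x : ℕ → S) : truncTime i θ x ≤ θ := by
  classical
  rw [truncTime_eq_sum]
  refine (Finset.sum_le_card_nsmul _ _ 1 fun n _ => ?_).trans (by simp)
  split_ifs <;> simp

variable [Fintype S] [DecidableEq S] [MeasurableSpace S] [MeasurableSingletonClass S]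

lemma measurable_truncTime {S : Type*} [MeasurableSpace S] [MeasurableSingletonClass S]
    (i : S) (θ : ℕ) : Measurable (truncTime (S := S) i θ) := by
  classical
  have : truncTime (S := S) i θ = fun x =>
      ∑ n ∈ Finset.range θ, if (n : ℕ∞) < returnTime i x then 1 else 0 :=
    funext (truncTime_eq_sum i θ)
  rw [this]
  exact Finset.measurable_sum _ fun n _ =>
    Measurable.ite (measurableSet_lt_returnTime i n) measurable_const measurable_const

/-- The mean of the truncated return time. -/
lemma integral_truncTime (P : Matrix.rowStochastic ℝ S) (i : S) (θ : ℕ) :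
    ∫ x, (truncTime i θ x : ℝ) ∂(chainLaw P i) =
      ∑ n ∈ Finset.range θ, avoid (P : Matrix S S ℝ) i n i := by
  classical
  have h : ∀ x : ℕ → S, (truncTime i θ x : ℝ) = ∑ n ∈ Finset.range θ,
      {x : ℕ → S | (n : ℕ∞) < returnTime i x}.indicator (fun _ => (1 : ℝ)) x := by
    intro x
    rw [truncTime_eq_sum]
    simp [Set.indicator_apply]
  simp_rw [h]
  rw [integral_finsetSum _ fun n _ =>
    (integrable_const _).indicator (measurableSet_lt_returnTime i n)]
  refine Finset.sum_congr rfl fun n _ => ?_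
  rw [integral_indicator_const _ (measurableSet_lt_returnTime i n), smul_eq_mul, mul_one,
    ← returnTail_eq, returnTail]

end TruncTime

/-! ### Decay and summability of the avoidance probabilities. -/

section AvoidBounds

variable {S : Type*} [Fintype S] [DecidableEq S] {A : Matrix S S ℝ}

lemma avoid_zero (A : Matrix S S ℝ) (i : S) : avoid A i 0 = 1 := by
  simp [avoid]

lemma avoid_add (A : Matrix S S ℝ) (i : S) (n m : ℕ) :
    avoid A i (n + m) = Matrix.mulVec (taboo A i ^ n) (avoid A i m) := by
  rw [avoid, avoid, pow_add, Matrix.mulVec_mulVec]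

lemma avoid_apply_eq_sum (A : Matrix S S ℝ) (i : S) (n : ℕ) (j : S) :
    avoid A i n j = ∑ k, (taboo A i ^ n) j k := by
  simp [avoid, Matrix.mulVec, dotProduct]

/-- If the probability of avoiding `i` for `m` steps is at most `c` from any starting point, then
`m` extra steps multiply the avoidance probability by at most `c`. -/
lemma avoid_add_le (hA : ∀ j k, 0 ≤ A j k) {i : S} {m : ℕ} {c : ℝ}
    (h : ∀ j, avoid A i m j ≤ c) (n : ℕ) (j : S) :
    avoid A i (n + m) j ≤ c * avoid A i n j := by
  rw [avoid_add, avoid_apply_eq_sum, Finset.mul_sum]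
  simp only [Matrix.mulVec, dotProduct]
  refine Finset.sum_le_sum fun k _ => ?_
  rw [mul_comm c]
  exact mul_le_mul_of_nonneg_left (h k) (taboo_pow_nonneg hA i n j k)

lemma taboo_pow_le (hA : ∀ j k, 0 ≤ A j k) (i : S) (n : ℕ) (j k : S) :
    (taboo A i ^ n) j k ≤ (A ^ n) j k := by
  induction n generalizing j k with
  | zero => simp
  | succ n ih =>
    rw [pow_succ, pow_succ, Matrix.mul_apply, Matrix.mul_apply]
    refine Finset.sum_le_sum fun l _ => mul_le_mul (ih j l) ?_ ?_
      ((taboo_pow_nonneg hA i n j l).trans (ih j l))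
    · simp only [taboo, Matrix.of_apply]
      split_ifs
      exacts [hA l k, le_rfl]
    · simpa using taboo_pow_nonneg hA i 1 l k

variable (hA : A ∈ Matrix.rowStochastic ℝ S)
include hA

lemma avoid_le_one (i : S) (n : ℕ) (j : S) : avoid A i n j ≤ 1 := by
  have hnn := (Matrix.mem_rowStochastic_iff_sum.1 hA).1
  rw [avoid_apply_eq_sum, ← Matrix.sum_row_of_mem_rowStochastic (pow_mem hA n) j]
  exact Finset.sum_le_sum fun k _ => taboo_pow_le hnn i n j k

lemma avoid_antitone (i j : S) : Antitone fun n => avoid A i n j := by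
  have hnn := (Matrix.mem_rowStochastic_iff_sum.1 hA).1
  refine antitone_nat_of_succ_le fun n => ?_
  simpa using avoid_add_le hnn (avoid_le_one hA i 1) n j

lemma avoid_lt_one_of_pow_pos {i j : S} {n : ℕ} (hn : 0 < n) (h : 0 < (A ^ n) j i) :
    avoid A i n j < 1 := by
  have hnn := (Matrix.mem_rowStochastic_iff_sum.1 hA).1
  rw [avoid_apply_eq_sum, ← Matrix.sum_row_of_mem_rowStochastic (pow_mem hA n) j]
  refine Finset.sum_lt_sum (fun k _ => taboo_pow_le hnn i n j k) ⟨i, Finset.mem_univ i, ?_⟩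
  -- Positivity of `n` supplies a last taboo factor, whose column `i` vanishes; this is the strict
  -- loss against `A ^ n`.
  obtain ⟨m, rfl⟩ := Nat.exists_eq_succ_of_ne_zero hn.ne'
  refine lt_of_eq_of_lt ?_ h
  rw [Nat.succ_eq_add_one, pow_succ, Matrix.mul_apply]
  simp [taboo]

/-- The mean return time to a state of an irreducible finite chain is finite. -/
lemma summable_avoid (hirr : A.IsIrreducible) (i j : S) : Summable fun n => avoid A i n j := by
  have hnn := (Matrix.mem_rowStochastic_iff_sum.1 hA).1
  choose k hk0 hk using fun l => (Matrix.isIrreducible_iff_exists_pow_pos hnn).1 hirr l i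
  have hlt : ∀ l, avoid A i (k l) l < 1 := fun l => avoid_lt_one_of_pow_pos hA (hk0 l) (hk l)
  -- Since avoidance decreases in time, one horizon `N` serves all starting points.
  set N := Finset.univ.sup k
  have hN : ∀ l, avoid A i N l < 1 := fun l =>
    (avoid_antitone hA i l (Finset.le_sup (Finset.mem_univ l))).trans_lt (hlt l)
  obtain ⟨l₀, -, hl₀⟩ := Finset.exists_max_image Finset.univ (avoid A i N) ⟨j, Finset.mem_univ j⟩
  set ρ := avoid A i N l₀
  have hρ : ρ < 1 := hN l₀
  -- The constant solves `s ≤ N + ρ s` for the partial sums `s`.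
  refine summable_of_sum_range_le (c := N / (1 - ρ)) (fun n => avoid_nonneg hnn i n j) fun M => ?_
  have h1 : ∑ n ∈ Finset.range M, avoid A i n j ≤
      N + ∑ n ∈ Finset.range M, avoid A i (n + N) j := by
    calc ∑ n ∈ Finset.range M, avoid A i n j ≤ ∑ n ∈ Finset.range (N + M), avoid A i n j :=
          Finset.sum_le_sum_of_subset_of_nonneg (Finset.range_mono (Nat.le_add_left M N))
            fun n _ _ => avoid_nonneg hnn i n j
      _ = ∑ n ∈ Finset.range N, avoid A i n j + ∑ n ∈ Finset.range M, avoid A i (n + N) j := by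
          rw [Finset.sum_range_add]
          simp_rw [add_comm N]
      _ ≤ N + ∑ n ∈ Finset.range M, avoid A i (n + N) j := by
          gcongr
          refine (Finset.sum_le_card_nsmul _ _ 1 fun n _ => avoid_le_one hA i n j).trans ?_
          simp
  have h2 : ∑ n ∈ Finset.range M, avoid A i (n + N) j ≤
      ρ * ∑ n ∈ Finset.range M, avoid A i n j := by
    rw [Finset.mul_sum]
    exact Finset.sum_le_sum fun n _ =>
      avoid_add_le hnn (fun l => hl₀ l (Finset.mem_univ l)) n j
  rw [le_div_iff₀ (by linarith)]
  linarith

/-- Exponential decay of the return time tail in terms of a bound `H` on the mean hitting times. -/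
lemma avoid_le_two_mul_rpow (hirr : A.IsIrreducible) (i : S) {H : ℝ}
    (hH : ∀ j, ∑' n, avoid A i n j ≤ H) (n : ℕ) (j : S) :
    avoid A i n j ≤ 2 * (2 : ℝ) ^ (-((n : ℝ) / (2 * H))) := by
  have hnn := (Matrix.mem_rowStochastic_iff_sum.1 hA).1
  have hsum := summable_avoid hA hirr i
  have hH1 : 1 ≤ H := by
    refine le_trans ?_ (hH j)
    have := (hsum j).le_tsum 0 fun n _ => avoid_nonneg hnn i n j
    simpa [avoid_zero] using this
  -- Markov's inequality in disguise: the `m + 1 > 2H` terms with index at most `m` are decreasing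
  -- and sum to at most `H`, so the last is at most 1/2.
  set m := ⌊2 * H⌋₊
  have hm : (m : ℝ) ≤ 2 * H := Nat.floor_le (by linarith)
  have hm' : 2 * H < m + 1 := Nat.lt_floor_add_one _
  have hm0 : (0 : ℝ) < m := by linarith
  have hhalf : ∀ l, avoid A i m l ≤ 1 / 2 := by
    intro l
    have h1 : ((m : ℝ) + 1) * avoid A i m l ≤ H := by
      refine le_trans ?_ (((hsum l).sum_le_tsum (Finset.range (m + 1))
        fun n _ => avoid_nonneg hnn i n l).trans (hH l))
      have := Finset.card_nsmul_le_sum (Finset.range (m + 1)) (fun n => avoid A i n l)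
        (avoid A i m l) fun n hn => avoid_antitone hA i l
          (Nat.lt_succ_iff.1 (Finset.mem_range.1 hn))
      simpa using this
    have h2 := avoid_nonneg hnn i m l
    nlinarith
  have hpow : ∀ q l, avoid A i (q * m) l ≤ (1 / 2 : ℝ) ^ q := by
    intro q l
    induction q with
    | zero => simp [avoid_zero]
    | succ q ih =>
      rw [add_mul, one_mul, pow_succ, mul_comm (_ ^ q)]
      exact (avoid_add_le hnn hhalf _ l).trans (by gcongr)
  have hmn : 0 < m := by exact_mod_cast hm0
  set q := n / m
  -- Rounding `n / m` down loses at most one block, hence the prefactor 2.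
  have hq : (n : ℝ) / (2 * H) ≤ q + 1 := by
    have h1 : n < m * (q + 1) := Nat.lt_mul_div_succ n hmn
    have h2 : (n : ℝ) < m * (q + 1) := by exact_mod_cast h1
    rw [div_le_iff₀ (by linarith)]
    nlinarith
  calc avoid A i n j ≤ avoid A i (q * m) j := avoid_antitone hA i j (Nat.div_mul_le_self n m)
    _ ≤ (1 / 2 : ℝ) ^ q := hpow q j
    _ = 2 * (2 : ℝ) ^ (-((q : ℝ) + 1)) := by
        rw [Real.rpow_neg (by norm_num), Real.rpow_add_one (by norm_num), Real.rpow_natCast]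
        simp
    _ ≤ 2 * (2 : ℝ) ^ (-((n : ℝ) / (2 * H))) := by
        gcongr
        norm_num

/-- The mean time to hit `i` that remains after `n` steps avoiding `i`. -/
lemma sum_taboo_pow_mul_tsum (hirr : A.IsIrreducible) (i j : S) (n : ℕ) :
    ∑ k, (taboo A i ^ n) j k * ∑' m, avoid A i m k =
      ∑' m, avoid A i m j - ∑ m ∈ Finset.range n, avoid A i m j := by
  rw [← (summable_avoid hA hirr i j).sum_add_tsum_nat_add n, add_sub_cancel_left]
  simp_rw [← tsum_mul_left]
  rw [← Summable.tsum_finsetSum fun k _ => (summable_avoid hA hirr i k).mul_left _]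
  refine tsum_congr fun m => ?_
  rw [add_comm m, avoid_add]
  rfl

end AvoidBounds

/-! ### Kac's formula, the fundamental matrix and the bias. -/

section Fundamental

variable {S : Type*} [Fintype S] [DecidableEq S] {A : Matrix S S ℝ}
  (hA : A ∈ Matrix.rowStochastic ℝ S) (hirr : A.IsIrreducible)
include hA hirr

/-- A harmonic `w` vanishing at `i` is also fixed by the taboo matrix, whose powers tend to zero. -/
lemma eq_zero_of_mulVec_eq_self {i : S} {w : S → ℝ} (hw : Matrix.mulVec A w = w)
    (hi : w i = 0) : w = 0 := by
  have hnn := (Matrix.mem_rowStochastic_iff_sum.1 hA).1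
  have h1 : Matrix.mulVec (taboo A i) w = w := by
    conv_rhs => rw [← hw]
    funext j
    simp only [Matrix.mulVec, dotProduct, taboo, Matrix.of_apply]
    refine Finset.sum_congr rfl fun k _ => ?_
    split_ifs with h
    · simp [h, hi]
    · rfl
  have h2 : ∀ n, Matrix.mulVec (taboo A i ^ n) w = w := by
    intro n
    induction n with
    | zero => simp
    | succ n ih => rw [pow_succ, ← Matrix.mulVec_mulVec, h1, ih]
  funext j
  have h3 : ∀ n, |w j| ≤ (∑ k, |w k|) * avoid A i n j := by
    intro n
    rw [← congrFun (h2 n) j, avoid_apply_eq_sum, Finset.mul_sum]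
    simp only [Matrix.mulVec, dotProduct]
    refine (Finset.abs_sum_le_sum_abs _ _).trans (Finset.sum_le_sum fun k _ => ?_)
    rw [abs_mul, abs_of_nonneg (taboo_pow_nonneg hnn i n j k), mul_comm]
    refine mul_le_mul_of_nonneg_right ?_ (taboo_pow_nonneg hnn i n j k)
    exact Finset.single_le_sum (f := fun k => |w k|) (fun _ _ => abs_nonneg _)
      (Finset.mem_univ k)
  have h4 : Filter.Tendsto (fun n => (∑ k, |w k|) * avoid A i n j) Filter.atTop (nhds 0) := by
    simpa using (summable_avoid hA hirr i j).tendsto_atTop_zero.const_mul (∑ k, |w k|)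
  exact abs_nonpos_iff.1 (ge_of_tendsto' h4 h3)

/-- The Poisson equation for the mean return times. -/
lemma mulVec_tsum_avoid (i j : S) :
    ∑ k, A j k * ∑' m, avoid A i m k =
      ∑' m, avoid A i m j - 1 + A j i * ∑' m, avoid A i m i := by
  have h := sum_taboo_pow_mul_tsum hA hirr i j 1
  simp only [pow_one, Finset.range_one, Finset.sum_singleton, avoid_zero, Pi.one_apply] at h
  rw [← h, ← Finset.add_sum_erase _ _ (Finset.mem_univ i),
    ← Finset.add_sum_erase (a := i) (f := fun k => taboo A i j k * _) _ (Finset.mem_univ i)]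
  rw [Finset.sum_congr rfl (g := fun k => taboo A i j k * ∑' m, avoid A i m k)]
  · simp [taboo]
    ring
  · intro k hk
    simp [taboo, Finset.ne_of_mem_erase hk]

variable {π : S → ℝ} (hπ : IsStationary A π)
include hπ

/-- For `u` in the kernel, pairing with `π` gives `π ⬝ᵥ u = 0`, so `u` is harmonic. Subtracting its
value at `i` shows that it is constant, and the constant is then `π ⬝ᵥ u = 0`. -/
lemma isUnit_det_fundamental : IsUnit (1 - A + Matrix.of fun _ k => π k).det := by
  rw [← Matrix.isUnit_iff_isUnit_det, ← Matrix.mulVec_injective_iff_isUnit]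
  intro v w hvw
  rw [← sub_eq_zero] at hvw ⊢
  rw [← Matrix.mulVec_sub] at hvw
  generalize v - w = u at hvw
  have h1 : Matrix.mulVec A u = u + fun _ => π ⬝ᵥ u := by
    rw [Matrix.add_mulVec, Matrix.sub_mulVec, Matrix.one_mulVec] at hvw
    funext j
    have := congrFun hvw j
    simp only [Pi.add_apply, Pi.sub_apply, Pi.zero_apply] at this
    have h2 : Matrix.mulVec (Matrix.of fun _ k => π k) u j = π ⬝ᵥ u := rfl
    rw [h2] at this
    simp only [Pi.add_apply]
    linarith
  have hπ1 : ∑ k, π k = 1 := hπ.1.2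
  have h2 : π ⬝ᵥ u = 0 := by
    have h3 := congrArg (fun z => π ⬝ᵥ z) h1
    rw [Matrix.dotProduct_mulVec, hπ.2, dotProduct_add] at h3
    have h4 : (π ⬝ᵥ fun _ : S => π ⬝ᵥ u) = π ⬝ᵥ u := by
      simp only [dotProduct, ← Finset.sum_mul, hπ1, one_mul]
    linarith
  have h5 : Matrix.mulVec A u = u := by
    rw [h1, h2]
    funext j
    simp
  rcases isEmpty_or_nonempty S with hS | ⟨⟨i⟩⟩
  · exact Subsingleton.elim _ _
  have h6 : u - (fun _ => u i) = 0 := by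
    refine eq_zero_of_mulVec_eq_self (i := i) hA hirr ?_ (by simp)
    rw [Matrix.mulVec_sub, h5]
    congr 1
    funext j
    simp only [Matrix.mulVec, dotProduct, ← Finset.sum_mul,
      Matrix.sum_row_of_mem_rowStochastic hA, one_mul]
  have h7 : ∀ k, u k = u i := fun k => sub_eq_zero.1 (congrFun h6 k)
  have h8 : u i = 0 := by
    rw [← h2]
    simp only [dotProduct]
    simp_rw [h7]
    rw [← Finset.sum_mul, hπ1, one_mul]
  funext k
  rw [h7, h8, Pi.zero_apply]

/-- Kac's formula. -/
lemma stationary_mul_tsum_avoid (i : S) : π i * ∑' m, avoid A i m i = 1 := by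
  have hπ1 : ∑ k, π k = 1 := hπ.1.2
  have h1 : ∀ v : S → ℝ, ∑ j, π j * ∑ k, A j k * v k = ∑ k, π k * v k := by
    intro v
    have := congrArg (· ⬝ᵥ v) hπ.2
    simp only [← Matrix.dotProduct_mulVec] at this
    exact this
  -- Pairing the Poisson equation with `π` cancels the mean times and leaves `π i * h i - 1 = 0`.
  have h2 := h1 fun k => ∑' m, avoid A i m k
  simp_rw [mulVec_tsum_avoid hA hirr, mul_add, mul_sub, Finset.sum_add_distrib,
    Finset.sum_sub_distrib, mul_one, hπ1, ← mul_assoc, ← Finset.sum_mul] at h2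
  have h3 : ∑ j, π j * A j i = π i := congrFun hπ.2 i
  rw [h3] at h2
  linarith

/-- Mean hitting times in terms of the fundamental matrix. -/
lemma stationary_mul_tsum_avoid_of_ne {i q : S} (hq : q ≠ i) :
    π i * ∑' m, avoid A i m q =
      fundamentalMatrix A π i i - fundamentalMatrix A π q i := by
  set h : S → ℝ := fun k => ∑' m, avoid A i m k with hh
  set B : Matrix S S ℝ := 1 - A + Matrix.of fun _ k => π k with hB
  have hπ1 : ∑ k, π k = 1 := hπ.1.2
  have hkac : π i * h i = 1 := stationary_mul_tsum_avoid hA hirr hπ i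
  have hdet : IsUnit B.det := isUnit_det_fundamental hA hirr hπ
  -- `π i` times the mean hitting time counted from time 0, hence zero at `i`. It satisfies `B g =
  -- const - e_i`; applying `B⁻¹`, which fixes constants, exhibits column `i` of `Z`.
  set g : S → ℝ := fun k => if k = i then 0 else π i * h k with hg
  set c : ℝ := 1 + π ⬝ᵥ g with hc
  have hAg : ∀ j, ∑ k, A j k * g k = π i * (h j - 1) := by
    intro j
    have h1 := mulVec_tsum_avoid hA hirr i j
    have h2 : ∑ k, A j k * g k = π i * ∑ k, A j k * h k - A j i * (π i * h i) := by
      rw [Finset.mul_sum, ← Finset.add_sum_erase _ _ (Finset.mem_univ i),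
        ← Finset.add_sum_erase (a := i) (f := fun k => π i * (A j k * h k)) _ (Finset.mem_univ i)]
      rw [Finset.sum_congr rfl (g := fun k => π i * (A j k * h k))]
      · simp [hg]
        ring
      · intro k hk
        simp only [hg, if_neg (Finset.ne_of_mem_erase hk)]
        ring
    rw [h2]
    simp only [hh] at h1 ⊢
    rw [h1]
    ring
  have hBg : Matrix.mulVec B g = fun j => π i + π ⬝ᵥ g - if j = i then 1 else 0 := by
    funext j
    rw [hB, Matrix.add_mulVec, Matrix.sub_mulVec, Matrix.one_mulVec]
    have h2 : Matrix.mulVec (Matrix.of fun _ k => π k) g j = π ⬝ᵥ g := rfl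
    have h3 : Matrix.mulVec A g j = π i * (h j - 1) := hAg j
    rw [Pi.add_apply, Pi.sub_apply, h2, h3]
    by_cases hj : j = i
    · subst hj
      simp only [hg, if_true]
      linear_combination -hkac
    · simp only [hg, if_neg hj]
      ring
  have hB1 : Matrix.mulVec B 1 = 1 := by
    funext j
    rw [hB, Matrix.add_mulVec, Matrix.sub_mulVec, Matrix.one_mulVec,
      Matrix.one_vecMul_of_mem_rowStochastic hA]
    simp [Matrix.mulVec, dotProduct, hπ1]
  have hZ : ∀ v w, Matrix.mulVec B v = w → v = Matrix.mulVec (fundamentalMatrix A π) w := by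
    rintro v w rfl
    rw [Matrix.mulVec_mulVec, fundamentalMatrix, ← hB, Matrix.nonsing_inv_mul _ hdet,
      Matrix.one_mulVec]
  have hZ1 : ∀ j, ∑ k, fundamentalMatrix A π j k = 1 := by
    intro j
    have := congrFun (hZ _ _ hB1) j
    simp only [Matrix.mulVec, dotProduct, Pi.one_apply, mul_one] at this
    exact this.symm
  have hgZ : ∀ j, g j = (π i + π ⬝ᵥ g) - fundamentalMatrix A π j i := by
    intro j
    have := congrFun (hZ _ _ hBg) j
    simp only [Matrix.mulVec, dotProduct, mul_sub, Finset.sum_sub_distrib, ← Finset.sum_mul,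
      hZ1, one_mul, mul_ite, mul_one, mul_zero, Finset.sum_ite_eq', Finset.mem_univ,
      if_true] at this
    exact this
  have hi := hgZ i
  have hq' := hgZ q
  simp only [hg, if_true, if_neg hq] at hi hq'
  linarith

/-- The bias of the truncated estimator. -/
lemma abs_bias_le (i : S) (n : ℕ) :
    |(1 - avoid A i n i) - π i * ∑ m ∈ Finset.range n, avoid A i m i| ≤
      avoid A i n i * max (2 * Zmax A π i - 1) 1 := by
  have hnn := (Matrix.mem_rowStochastic_iff_sum.1 hA).1
  have hkac := stationary_mul_tsum_avoid hA hirr hπ i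
  have h1 := sum_taboo_pow_mul_tsum hA hirr i i n
  have h2 : (1 - avoid A i n i) - π i * ∑ m ∈ Finset.range n, avoid A i m i =
      ∑ k, (taboo A i ^ n) i k * (π i * ∑' m, avoid A i m k - 1) := by
    simp_rw [mul_sub, Finset.sum_sub_distrib, mul_one, ← avoid_apply_eq_sum]
    have h3 : ∑ k, (taboo A i ^ n) i k * (π i * ∑' m, avoid A i m k) =
        π i * (∑' m, avoid A i m i - ∑ m ∈ Finset.range n, avoid A i m i) := by
      rw [← h1, Finset.mul_sum]
      exact Finset.sum_congr rfl fun k _ => by ring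
    rw [h3]
    linear_combination -hkac
  have hZle : ∀ k, |fundamentalMatrix A π k i| ≤ Zmax A π i := fun k =>
    le_ciSup (f := fun k => |fundamentalMatrix A π k i|) (Set.finite_range _).bddAbove k
  have hbd : ∀ k, |π i * ∑' m, avoid A i m k - 1| ≤ max (2 * Zmax A π i - 1) 1 := by
    intro k
    have hnn' : 0 ≤ π i * ∑' m, avoid A i m k :=
      mul_nonneg (hπ.1.1 i) (tsum_nonneg fun m => avoid_nonneg hnn i m k)
    by_cases hk : k = i
    · subst hk
      rw [hkac]
      simp
    -- The lower bound `-1` needs only nonnegativity of hitting times; the upper one is `Z_ii - Z_ki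
    -- - 1 ≤ 2 Z_max - 1`.
    · rw [abs_le]
      constructor
      · linarith [le_max_right (2 * Zmax A π i - 1) 1]
      · refine le_trans ?_ (le_max_left _ _)
        rw [stationary_mul_tsum_avoid_of_ne hA hirr hπ hk]
        have ha := (abs_le.1 (hZle i)).2
        have hb := (abs_le.1 (hZle k)).1
        linarith
  rw [h2, avoid_apply_eq_sum, Finset.sum_mul]
  refine (Finset.abs_sum_le_sum_abs _ _).trans (Finset.sum_le_sum fun k _ => ?_)
  rw [abs_mul, abs_of_nonneg (taboo_pow_nonneg hnn i n i k)]
  exact mul_le_mul_of_nonneg_left (hbd k) (taboo_pow_nonneg hnn i n i k)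

end Fundamental

/-! ### The tail bound in terms of `H_i`. -/

section MaxHitting

variable {S : Type*} [Fintype S] [DecidableEq S] [MeasurableSpace S] [MeasurableSingletonClass S]

lemma tsum_avoid_le_maxHittingTime (P : Matrix.rowStochastic ℝ S)
    (hP : (P : Matrix S S ℝ).IsIrreducible) (i j : S) :
    ∑' n, avoid (P : Matrix S S ℝ) i n j ≤ maxHittingTime P i := by
  have hnn := (Matrix.mem_rowStochastic_iff_sum.1 P.2).1
  have h : ∀ k, meanTime P k i = ENNReal.ofReal (∑' n, avoid (P : Matrix S S ℝ) i n k) := by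
    intro k
    rw [meanTime_eq_tsum, ENNReal.ofReal_tsum_of_nonneg (fun n => avoid_nonneg hnn i n k)
      (summable_avoid P.2 hP i k)]
  rw [maxHittingTime, ← ENNReal.toReal_ofReal (tsum_nonneg fun n => avoid_nonneg hnn i n j), ← h]
  refine ENNReal.toReal_mono ?_ (le_iSup (fun k => meanTime P k i) j)
  -- `toReal` is monotone only below `⊤`, so the supremum is first bounded by a finite sum of finite
  -- means.
  have hle : ⨆ k, meanTime P k i ≤ ∑ k, meanTime P k i :=
    iSup_le fun k => Finset.single_le_sum (f := fun k => meanTime P k i)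
      (fun _ _ => zero_le) (Finset.mem_univ k)
  refine ne_top_of_le_ne_top (ENNReal.sum_ne_top.2 fun k _ => ?_) hle
  rw [h]
  exact ENNReal.ofReal_ne_top

lemma returnTail_le (P : Matrix.rowStochastic ℝ S)
    (hP : (P : Matrix S S ℝ).IsIrreducible) (i : S) (n : ℕ) :
    returnTail P i n ≤ 2 * (2 : ℝ) ^ (-((n : ℝ) / (2 * maxHittingTime P i))) := by
  rw [returnTail_eq]
  exact avoid_le_two_mul_rpow P.2 hP i (tsum_avoid_le_maxHittingTime P hP i) n i

end MaxHitting

/-! ### Multiplicative Chernoff bounds. -/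

section Chernoff

variable {Ω : Type*} [MeasurableSpace Ω] {μ : Measure Ω} [IsProbabilityMeasure μ]

lemma integrable_of_mem_unitInterval {Y : Ω → ℝ} (hY : Measurable Y)
    (h01 : ∀ ω, Y ω ∈ Set.Icc (0 : ℝ) 1) : Integrable Y μ :=
  Integrable.of_bound hY.aestronglyMeasurable 1
    (Filter.Eventually.of_forall fun ω => by
      rw [Real.norm_eq_abs, abs_of_nonneg (h01 ω).1]; exact (h01 ω).2)

lemma integrable_exp_mul_of_mem_Icc {Y : Ω → ℝ} (hY : Measurable Y) {b : ℝ}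
    (h0b : ∀ ω, Y ω ∈ Set.Icc (0 : ℝ) b) (t : ℝ) : Integrable (fun ω => Real.exp (t * Y ω)) μ := by
  refine Integrable.of_bound (by fun_prop) (Real.exp (|t| * b))
    (Filter.Eventually.of_forall fun ω => ?_)
  rw [Real.norm_eq_abs, Real.abs_exp, Real.exp_le_exp]
  calc t * Y ω ≤ |t| * Y ω := mul_le_mul_of_nonneg_right (le_abs_self t) (h0b ω).1
    _ ≤ |t| * b := mul_le_mul_of_nonneg_left (h0b ω).2 (abs_nonneg t)

/-- On `[0, 1]` the convex `exp (t y)` lies below its chord `1 + y (exp t - 1)`; then `1 + x ≤ exp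
x`. -/
lemma mgf_le_of_mem_unitInterval {Y : Ω → ℝ} (hY : Measurable Y)
    (h01 : ∀ ω, Y ω ∈ Set.Icc (0 : ℝ) 1) (t : ℝ) :
    mgf Y μ t ≤ Real.exp (μ[Y] * (Real.exp t - 1)) := by
  have hint := integrable_of_mem_unitInterval (μ := μ) hY h01
  calc mgf Y μ t ≤ ∫ ω, (1 + Y ω * (Real.exp t - 1)) ∂μ := by
        refine integral_mono (integrable_exp_mul_of_mem_Icc hY h01 t)
          ((integrable_const _).add (hint.mul_const _)) fun ω => ?_
        have h := convexOn_exp.2 (Set.mem_univ 0) (Set.mem_univ t)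
          (sub_nonneg.2 (h01 ω).2) (h01 ω).1 (by ring)
        simp only [smul_eq_mul, mul_zero, zero_add, Real.exp_zero, mul_one] at h
        rw [mul_comm t]
        linarith
    _ = 1 + μ[Y] * (Real.exp t - 1) := by
        rw [integral_add (integrable_const _) (hint.mul_const _), integral_mul_const]
        simp
    _ ≤ _ := by
        rw [add_comm]
        exact Real.add_one_le_exp _

variable {Y : ℕ → Ω → ℝ}

lemma mgf_sum_le (hY : ∀ k, Measurable (Y k)) (hind : iIndepFun Y μ)
    (h01 : ∀ k ω, Y k ω ∈ Set.Icc (0 : ℝ) 1) {m : ℝ} (hm : ∀ k, μ[Y k] = m) (N : ℕ) (t : ℝ) :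
    mgf (∑ k ∈ Finset.range N, Y k) μ t ≤ Real.exp (N * m * (Real.exp t - 1)) := by
  rw [hind.mgf_sum hY]
  calc ∏ k ∈ Finset.range N, mgf (Y k) μ t
      ≤ ∏ _k ∈ Finset.range N, Real.exp (m * (Real.exp t - 1)) :=
        Finset.prod_le_prod (fun _ _ => mgf_nonneg) fun k _ => by
          rw [← hm k]; exact mgf_le_of_mem_unitInterval (hY k) (h01 k) t
    _ = _ := by
        rw [Finset.prod_const, Finset.card_range, ← Real.exp_nat_mul]
        ring_nf

/-- The multiplicative Chernoff bound for `[0, 1]`-valued variables. -/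
lemma chernoff_unitInterval (hY : ∀ k, Measurable (Y k)) (hind : iIndepFun Y μ)
    (h01 : ∀ k ω, Y k ω ∈ Set.Icc (0 : ℝ) 1) {m : ℝ} (hm : ∀ k, μ[Y k] = m)
    {ε : ℝ} (hε0 : 0 < ε) (hε1 : ε < 1) (N : ℕ) :
    μ.real {ω | ε * (N * m) ≤ |∑ k ∈ Finset.range N, Y k ω - N * m|} ≤
      2 * Real.exp (-(ε ^ 2 * (N * m) / 3)) := by
  have hm0 : 0 ≤ m := by
    rw [← hm 0]; exact integral_nonneg fun ω => (h01 0 ω).1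
  have hM : 0 ≤ N * m := by positivity
  set M : ℝ := N * m
  have hsm : Measurable (∑ k ∈ Finset.range N, Y k) := by fun_prop
  have hsb : ∀ ω, (∑ k ∈ Finset.range N, Y k) ω ∈ Set.Icc (0 : ℝ) N := by
    intro ω
    rw [Finset.sum_apply]
    refine ⟨Finset.sum_nonneg fun k _ => (h01 k ω).1, ?_⟩
    refine (Finset.sum_le_card_nsmul _ _ 1 fun k _ => (h01 k ω).2).trans (by simp)
  have hup : μ.real {ω | (1 + ε) * M ≤ (∑ k ∈ Finset.range N, Y k) ω} ≤
      Real.exp (-(ε ^ 2 * M / 3)) := by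
    -- The optimal parameter is `log (1 + ε)`; this rational lower bound gives the constant 1/3 for
    -- `ε < 1`.
    have hl : 2 * ε / (ε + 2) ≤ Real.log (1 + ε) := Real.le_log_one_add_of_nonneg hε0.le
    have ht : 0 ≤ Real.log (1 + ε) := Real.log_nonneg (by linarith)
    refine (measure_ge_le_exp_mul_mgf _ ht (integrable_exp_mul_of_mem_Icc hsm hsb _)).trans ?_
    refine (mul_le_mul_of_nonneg_left (mgf_sum_le hY hind h01 hm N _)
      (Real.exp_pos _).le).trans ?_
    rw [← Real.exp_add, Real.exp_le_exp, Real.exp_log (by linarith)]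
    have h2 : ε + ε ^ 2 / 3 ≤ (1 + ε) * Real.log (1 + ε) := by
      refine le_trans ?_ (mul_le_mul_of_nonneg_left hl (by linarith))
      rw [mul_div_assoc', le_div_iff₀ (by linarith)]
      nlinarith [mul_pos hε0 hε0]
    have h3 := mul_le_mul_of_nonneg_right h2 hM
    change _ + M * (1 + ε - 1) ≤ _
    nlinarith
  have hlo : μ.real {ω | (∑ k ∈ Finset.range N, Y k) ω ≤ (1 - ε) * M} ≤
      Real.exp (-(ε ^ 2 * M / 3)) := by
    refine (measure_le_le_exp_mul_mgf _ (neg_nonpos.2 hε0.le)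
      (integrable_exp_mul_of_mem_Icc hsm hsb _)).trans ?_
    refine (mul_le_mul_of_nonneg_left (mgf_sum_le hY hind h01 hm N _)
      (Real.exp_pos _).le).trans ?_
    rw [← Real.exp_add, Real.exp_le_exp]
    -- For the lower tail the simpler parameter `-ε` is enough: it yields `ε ^ 2 / 2`, better than
    -- needed.
    have h1 : Real.exp (-ε) ≤ 1 - ε + ε ^ 2 / 2 := by
      have h := Real.quadratic_le_exp_of_nonneg hε0.le
      rw [Real.exp_neg]
      have hp : 0 < 1 + ε + ε ^ 2 / 2 := by positivity
      refine (inv_anti₀ hp h).trans ?_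
      rw [inv_le_iff_one_le_mul₀ hp]
      nlinarith [sq_nonneg (ε ^ 2)]
    have h3 := mul_le_mul_of_nonneg_right h1 hM
    change _ + M * (Real.exp (-ε) - 1) ≤ _
    nlinarith [mul_nonneg (sq_nonneg ε) hM]
  have hsub : {ω | ε * M ≤ |∑ k ∈ Finset.range N, Y k ω - M|} ⊆
      {ω | (1 + ε) * M ≤ (∑ k ∈ Finset.range N, Y k) ω} ∪
        {ω | (∑ k ∈ Finset.range N, Y k) ω ≤ (1 - ε) * M} := by
    intro ω hω
    simp only [Set.mem_union, Set.mem_ofPred_eq, Finset.sum_apply] at hω ⊢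
    rcases le_abs'.1 hω with h | h
    · right; linarith
    · left; linarith
  calc _ ≤ _ := measureReal_mono hsub
    _ ≤ _ := measureReal_union_le _ _
    _ ≤ _ := by linarith

/-- The multiplicative Chernoff bound for the average of `[0, b]`-valued variables. -/
lemma chernoff_average (hY : ∀ k, Measurable (Y k)) (hind : iIndepFun Y μ) {b : ℝ} (hb : 0 < b)
    (h0b : ∀ k ω, Y k ω ∈ Set.Icc (0 : ℝ) b) {m : ℝ} (hm : ∀ k, μ[Y k] = m)
    {ε : ℝ} (hε0 : 0 < ε) (hε1 : ε < 1) {N : ℕ} (hN : 0 < N) :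
    μ.real {ω | ε * m < |(∑ k ∈ Finset.range N, Y k ω) / N - m|} ≤
      2 * Real.exp (-(ε ^ 2 * (N * m) / (3 * b))) := by
  have hN' : (0 : ℝ) < N := by exact_mod_cast hN
  have h := chernoff_unitInterval (μ := μ) (Y := fun k ω => Y k ω / b) (m := m / b) (N := N)
    (fun k => (hY k).div_const b)
    (hind.comp (fun _ y => y / b) fun _ => measurable_id.div_const b)
    (fun k ω => ⟨div_nonneg (h0b k ω).1 hb.le, (div_le_one hb).2 (h0b k ω).2⟩)
    (fun k => by rw [integral_div, hm k]) hε0 hε1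
  refine (measureReal_mono ?_).trans (h.trans_eq ?_)
  · intro ω hω
    simp only [Set.mem_ofPred_eq] at hω ⊢
    have h1 : ∑ k ∈ Finset.range N, Y k ω / b - N * (m / b) =
        N / b * ((∑ k ∈ Finset.range N, Y k ω) / N - m) := by
      rw [← Finset.sum_div]
      field_simp
    rw [h1, abs_mul, abs_of_pos (div_pos hN' hb)]
    refine le_trans (le_of_eq ?_) (mul_le_mul_of_nonneg_left hω.le (div_pos hN' hb).le)
    ring
  · congr 2
    field_simp

end Chernoff

/-! ### Measurability and bounds for the empirical averages. -/

lemma measurableSet_lt_abs_sub {Ω : Type*} [MeasurableSpace Ω] {f : Ω → ℝ} (hf : Measurable f)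
    (a b : ℝ) : MeasurableSet {ω | a < |f ω - b|} :=
  measurableSet_lt measurable_const (measurable_norm.comp (hf.sub_const b))

lemma measurable_random_index {Ω : Type*} [MeasurableSpace Ω] {N : Ω → ℕ} (hN : Measurable N)
    {g : ℕ → Ω → ℝ} (hg : ∀ n, Measurable (g n)) : Measurable fun ω => g (N ω) ω :=
  (measurable_from_prod_countable_right (f := fun p : ℕ × Ω => g p.1 p.2) hg).comp
    (hN.prodMk measurable_id)

section Averages

variable {S : Type*}

lemma one_le_meanTruncTime (i : S) {θ N : ℕ} (hθ : 1 ≤ θ) (hN : 0 < N) (s : ℕ → ℕ → S) :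
    1 ≤ meanTruncTime i θ N s := by
  have hN' : (0 : ℝ) < N := by exact_mod_cast hN
  rw [meanTruncTime, le_div_iff₀ hN', one_mul]
  have := Finset.card_nsmul_le_sum (Finset.range N) (fun k => (truncTime i θ (s k) : ℝ)) 1
    fun k _ => by exact_mod_cast one_le_truncTime i hθ (s k)
  simpa using this

lemma meanTruncTime_le (i : S) (θ N : ℕ) (s : ℕ → ℕ → S) : meanTruncTime i θ N s ≤ θ := by
  rw [meanTruncTime]
  refine div_le_of_le_mul₀ (Nat.cast_nonneg _) (Nat.cast_nonneg _) ?_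
  refine (Finset.sum_le_card_nsmul _ _ (θ : ℝ) fun k _ => ?_).trans (by simp [mul_comm])
  exact_mod_cast truncTime_le i θ (s k)

open Classical in
lemma one_sub_truncFraction (i : S) (θ : ℕ) {N : ℕ} (hN : 0 < N) (s : ℕ → ℕ → S) :
    1 - truncFraction i θ N s =
      (∑ k ∈ Finset.range N, if (θ : ℕ∞) < returnTime i (s k) then (0 : ℝ) else 1) / N := by
  have hN' : (N : ℝ) ≠ 0 := by exact_mod_cast hN.ne'
  have h : ∀ k, (if (θ : ℕ∞) < returnTime i (s k) then (0 : ℝ) else 1) =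
      1 - if (θ : ℕ∞) < returnTime i (s k) then 1 else 0 := by
    intro k; split_ifs <;> simp
  simp_rw [h, Finset.sum_sub_distrib, Finset.sum_boole]
  rw [truncFraction, sub_div]
  simp [hN']

variable [MeasurableSpace S] [MeasurableSingletonClass S]
  {Ω : Type*} [MeasurableSpace Ω]

lemma measurable_meanTruncTime (i : S) (θ N : ℕ) {X : ℕ → Ω → (ℕ → S)}
    (hX : ∀ k, Measurable (X k)) :
    Measurable fun ω => meanTruncTime i θ N fun k => X k ω := by
  unfold meanTruncTime
  refine Measurable.div_const (Finset.measurable_fun_sum _ fun k _ => ?_) _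
  exact (measurable_from_top (f := fun n : ℕ => (n : ℝ))).comp
    ((measurable_truncTime i θ).comp (hX k))

lemma measurable_truncFraction (i : S) (θ N : ℕ) {X : ℕ → Ω → (ℕ → S)}
    (hX : ∀ k, Measurable (X k)) :
    Measurable fun ω => truncFraction i θ N fun k => X k ω := by
  classical
  have h : ∀ ω, truncFraction i θ N (fun k => X k ω) =
      (∑ k ∈ Finset.range N, if (θ : ℕ∞) < returnTime i (X k ω) then (1 : ℝ) else 0) / N := by
    intro ω
    rw [truncFraction, Finset.sum_boole]
  simp_rw [h]
  exact Measurable.div_const (Finset.measurable_fun_sum _ fun k _ =>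
    Measurable.ite (hX k (measurableSet_lt_returnTime i θ)) measurable_const measurable_const) _

/-- The numbers of samples of iteration `t` depend on the earlier samples only. -/
lemma measurable_numSamples (ε α : ℝ) (i : S) (X : ℕ → ℕ → Ω → (ℕ → S)) (t : ℕ)
    (hX : ∀ s < t, ∀ k, Measurable (X s k)) :
    Measurable fun ω => numSamples ε α i (fun s k => X s k ω) t := by
  induction t with
  | zero => simp only [numSamples]; exact measurable_const
  | succ t ih =>
    cases t with
    | zero => simp only [numSamples]; exact measurable_const
    | succ t =>
      simp only [numSamples]
      have hN := ih fun s hs => hX s (hs.trans (Nat.lt_succ_self _))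
      have hT' := measurable_random_index hN fun n =>
        measurable_meanTruncTime i (threshold (t + 1)) n (hX (t + 1) (Nat.lt_succ_self _))
      exact (measurable_const.div (hT'.mul_const _)).nat_ceil

lemma measurable_THat (ε α : ℝ) (i : S) (X : ℕ → ℕ → Ω → (ℕ → S)) (t : ℕ)
    (hX : ∀ s ≤ t, ∀ k, Measurable (X s k)) :
    Measurable fun ω => THat ε α i (fun s k => X s k ω) t := by
  have hN := measurable_numSamples ε α i X t fun s hs => hX s hs.le
  exact measurable_random_index hN fun n =>
    measurable_meanTruncTime i (threshold t) n (hX t le_rfl)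

end Averages

/-! ### Lower bounds on the sample sizes. -/

section SampleSize

variable {S : Type*} {ε α : ℝ} (hε0 : 0 < ε) (hα0 : 0 < α) (hα1 : α < 1)

lemma threshold_pos (t : ℕ) : 1 ≤ threshold t := Nat.one_le_two_pow

lemma cast_threshold (t : ℕ) : (threshold t : ℝ) = 2 ^ t := by simp [threshold]

lemma cast_threshold_succ (t : ℕ) : (threshold (t + 1) : ℝ) = 2 * threshold t := by
  rw [cast_threshold, cast_threshold, pow_succ, mul_comm]

-- The argument is at least 8 > e. With `L ≥ 1` for the logarithm, `(1 + ε) L ≥ L + ε`, the slack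
-- behind the factor `exp(-ε)`.
include hα0 hα1 in
lemma one_le_log_threshold {t : ℕ} (ht : 1 ≤ t) :
    1 ≤ Real.log (4 * (threshold t : ℝ) / α) := by
  have h1 : (2 : ℝ) ≤ threshold t := by
    rw [cast_threshold]
    simpa using pow_le_pow_right₀ (one_le_two (α := ℝ)) ht
  have h2 : (8 : ℝ) ≤ 4 * (threshold t : ℝ) / α := by
    rw [le_div_iff₀ hα0]
    nlinarith
  rw [Real.le_log_iff_exp_le (by linarith)]
  linarith [Real.exp_one_lt_d9]

include hε0 hα0 hα1

lemma numSamples_pos (i : S) (X : ℕ → ℕ → ℕ → S) {t : ℕ} (ht : 1 ≤ t) :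
    0 < numSamples ε α i X t := by
  induction t, ht using Nat.le_induction with
  | base =>
    have hl : 0 < Real.log (8 / α) := Real.log_pos (by rw [lt_div_iff₀ hα0]; linarith)
    simp only [numSamples]
    exact Nat.ceil_pos.2 (by positivity)
  | succ t ht ih =>
    obtain ⟨t, rfl⟩ := Nat.exists_eq_add_of_le' ht
    have hl := one_le_log_threshold hα0 hα1 (Nat.le_add_left 1 (t + 1))
    have hT := one_le_meanTruncTime i (threshold_pos (t + 1)) ih (X (t + 1))
    have hθ : (0 : ℝ) < threshold (t + 2) := by exact_mod_cast threshold_pos (t + 2)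
    simp only [numSamples]
    refine Nat.ceil_pos.2 (div_pos (mul_pos (by positivity) ?_) (by positivity))
    exact zero_lt_one.trans_le hl

lemma one_le_THat (i : S) (X : ℕ → ℕ → ℕ → S) {t : ℕ} (ht : 1 ≤ t) :
    1 ≤ THat ε α i X t :=
  one_le_meanTruncTime i (threshold_pos t) (numSamples_pos hε0 hα0 hα1 i X ht) (X t)

/-- The bound `c` is left free for two uses: the deterministic `θ⁽ᵗ⁾`, and `(1 + ε) τ⁽ᵗ⁺¹⁾` when
`T̂⁽ᵗ⁾` is accurate. -/
lemma mul_log_le_mul_numSamples (i : S) (X : ℕ → ℕ → ℕ → S) {t : ℕ} (ht : 1 ≤ t) {c : ℝ}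
    (hc : THat ε α i X t ≤ c) :
    3 * (1 + ε) * (threshold (t + 1) : ℝ) * Real.log (4 * (threshold (t + 1) : ℝ) / α) ≤
      ε ^ 2 * numSamples ε α i X (t + 1) * c := by
  have hT := one_le_THat hε0 hα0 hα1 i X ht
  obtain ⟨t, rfl⟩ := Nat.exists_eq_add_of_le' ht
  have h : 3 * (1 + ε) * (threshold (t + 2) : ℝ) * Real.log (4 * (threshold (t + 2) : ℝ) / α) /
      (THat ε α i X (t + 1) * ε ^ 2) ≤ numSamples ε α i X (t + 2) := by
    rw [numSamples]
    exact Nat.le_ceil _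
  rw [div_le_iff₀ (by positivity)] at h
  refine h.trans ?_
  have : (0 : ℝ) ≤ ε ^ 2 * numSamples ε α i X (t + 2) := by positivity
  nlinarith

/-- The deterministic lower bound on the number of samples. -/
lemma log_le_mul_numSamples (i : S) (X : ℕ → ℕ → ℕ → S) {t : ℕ} (ht : 1 ≤ t) :
    6 * (1 + ε) * Real.log (4 * (threshold t : ℝ) / α) ≤ ε ^ 2 * numSamples ε α i X t := by
  rcases ht.eq_or_lt with rfl | ht'
  · have h : 6 * (1 + ε) * Real.log (8 / α) / ε ^ 2 ≤ numSamples ε α i X 1 := by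
      rw [numSamples]
      exact Nat.le_ceil _
    rw [div_le_iff₀ (by positivity)] at h
    rw [cast_threshold]
    norm_num
    linarith
  · obtain ⟨s, rfl⟩ := Nat.exists_eq_add_of_le' ht
    have hs : 1 ≤ s := by omega
    -- Here `T̂⁽ˢ⁾ ≤ θ⁽ˢ⁾ = θ⁽ˢ⁺¹⁾ / 2`, which turns the factor 3 into 6.
    have h := mul_log_le_mul_numSamples hε0 hα0 hα1 i X hs
      (meanTruncTime_le i (threshold s) (numSamples ε α i X s) (X s))
    have hθ : (0 : ℝ) < threshold s := by exact_mod_cast threshold_pos s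
    rw [cast_threshold_succ] at h ⊢
    refine le_of_mul_le_mul_right ?_ hθ
    linarith

end SampleSize

/-! ### Concentration with random sample sizes; union bound over iterations. -/

section Concentration

/-- A bound for events selected by an independent random index. -/
lemma measure_inter_random_index_le {Ω : Type*} {m₁ m₂ m0 : MeasurableSpace Ω} {μ : Measure Ω}
    [IsProbabilityMeasure μ] (hind : Indep m₁ m₂ μ)
    {N : Ω → ℕ} (hN : Measurable[m₁] N) {G : Set Ω} (hG : MeasurableSet[m₁] G)
    (hm₁ : m₁ ≤ m0) {F : ℕ → Set Ω} (hF : ∀ n, MeasurableSet[m₂] (F n)) {c : ℝ≥0∞}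
    (hc : ∀ ω ∈ G, μ (F (N ω)) ≤ c) :
    μ (G ∩ {ω | ω ∈ F (N ω)}) ≤ c := by
  have hGn : ∀ n, MeasurableSet[m₁] (G ∩ N ⁻¹' {n}) := fun n =>
    MeasurableSet.inter hG (hN (measurableSet_singleton n))
  have hsub : G ∩ {ω | ω ∈ F (N ω)} ⊆ ⋃ n, (G ∩ N ⁻¹' {n}) ∩ F n := by
    rintro ω ⟨h1, h2⟩
    exact Set.mem_iUnion.2 ⟨N ω, ⟨h1, rfl⟩, h2⟩
  calc μ (G ∩ {ω | ω ∈ F (N ω)}) ≤ ∑' n, μ ((G ∩ N ⁻¹' {n}) ∩ F n) :=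
        (measure_mono hsub).trans (measure_iUnion_le _)
    _ ≤ ∑' n, c * μ (G ∩ N ⁻¹' {n}) := by
        refine ENNReal.tsum_le_tsum fun n => ?_
        rw [(Indep_iff _ _ _).1 hind _ _ (hGn n) (hF n), mul_comm c]
        -- `F n` is controlled only for values `n` that `N` attains on `G`; other fibres are empty.
        rcases (G ∩ N ⁻¹' {n}).eq_empty_or_nonempty with h | ⟨ω, h1, h2⟩
        · simp [h]
        · have := hc ω h1
          rw [show N ω = n from h2] at this
          gcongr
    _ = c * μ (⋃ n, G ∩ N ⁻¹' {n}) := by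
        rw [ENNReal.tsum_mul_left, measure_iUnion _ fun n => hm₁ _ (hGn n)]
        intro a b hab
        exact Set.disjoint_left.2 fun ω h1 h2 => hab (h1.2.symm.trans h2.2)
    _ ≤ c := by
        refine (mul_le_mul_right prob_le_one c).trans ?_
        rw [mul_one]

variable {S : Type*} [Fintype S] [DecidableEq S]

/-- The mean truncated return time `E_i[min(T_i, θ)]`. -/
def truncMean (P : Matrix.rowStochastic ℝ S) (i : S) (θ : ℕ) : ℝ :=
  ∑ n ∈ Finset.range θ, avoid (P : Matrix S S ℝ) i n i

lemma truncMean_mono (P : Matrix.rowStochastic ℝ S) (i : S) {θ θ' : ℕ} (h : θ ≤ θ') :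
    truncMean P i θ ≤ truncMean P i θ' :=
  Finset.sum_le_sum_of_subset_of_nonneg (Finset.range_mono h) fun n _ _ =>
    avoid_nonneg (fun _ _ => Matrix.nonneg_of_mem_rowStochastic P.2) i n i

lemma one_le_truncMean (P : Matrix.rowStochastic ℝ S) (i : S) {θ : ℕ} (h : 1 ≤ θ) :
    1 ≤ truncMean P i θ := by
  refine le_trans (le_of_eq ?_) (truncMean_mono P i h)
  simp [truncMean, avoid_zero]

variable [MeasurableSpace S] [MeasurableSingletonClass S]

variable {Ω : Type*} [mΩ : MeasurableSpace Ω] {μ : Measure Ω} [IsProbabilityMeasure μ]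
  (P : Matrix.rowStochastic ℝ S) (i : S) {ε α : ℝ}

section FixedSize

variable {X : ℕ → Ω → (ℕ → S)} (hX : ∀ k, Measurable (X k))
  (hlaw : ∀ k, μ.map (X k) = chainLaw P i) (hind : iIndepFun X μ)
  (hε0 : 0 < ε) (hε1 : ε < 1)
include hX hlaw hind hε0 hε1

lemma meanTruncTime_concentration {θ N : ℕ} (hθ : 1 ≤ θ) (hN : 0 < N) :
    μ.real {ω | ε * truncMean P i θ <
        |meanTruncTime i θ N (fun k => X k ω) - truncMean P i θ|} ≤
      2 * Real.exp (-(ε ^ 2 * (N * truncMean P i θ) / (3 * θ))) := by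
  have hθ' : (0 : ℝ) < θ := by exact_mod_cast hθ
  have hg : Measurable fun x : ℕ → S => (truncTime i θ x : ℝ) :=
    (measurable_from_top (f := fun n : ℕ => (n : ℝ))).comp (measurable_truncTime i θ)
  refine chernoff_average (Y := fun k ω => (truncTime i θ (X k ω) : ℝ))
    (fun k => hg.comp (hX k)) (hind.comp (fun _ x => (truncTime i θ x : ℝ)) fun _ => hg) hθ'
    (fun k ω => ⟨Nat.cast_nonneg _, by exact_mod_cast truncTime_le i θ (X k ω)⟩)
    (fun k => ?_) hε0 hε1 hN
  rw [truncMean, ← integral_truncTime, ← hlaw k,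
    integral_map (hX k).aemeasurable hg.aestronglyMeasurable]

/-- Chernoff is applied to the indicators of `T_i ≤ θ`, since the numerator `1 - p̂` needs a
relative error. -/
lemma truncFraction_concentration {θ N : ℕ} (hN : 0 < N) :
    μ.real {ω | ε * (1 - returnTail P i θ) <
        |truncFraction i θ N (fun k => X k ω) - returnTail P i θ|} ≤
      2 * Real.exp (-(ε ^ 2 * (N * (1 - returnTail P i θ)) / 3)) := by
  classical
  have hms := measurableSet_lt_returnTime i θ
  set g : (ℕ → S) → ℝ := fun x => if (θ : ℕ∞) < returnTime i x then (0 : ℝ) else 1 with hgdef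
  have hg : Measurable g := Measurable.ite hms measurable_const measurable_const
  have h := chernoff_average (μ := μ) (Y := fun k ω => g (X k ω)) (b := 1)
    (m := 1 - returnTail P i θ)
    (fun k => hg.comp (hX k)) (hind.comp (fun _ => g) fun _ => hg) one_pos
    (fun k ω => by simp only [hgdef]; split_ifs <;> simp)
    (fun k => ?_) hε0 hε1 hN
  · rw [mul_one] at h
    refine le_trans (le_of_eq ?_) h
    congr 1
    ext ω
    simp only [Set.mem_ofPred_eq]
    rw [← one_sub_truncFraction i θ hN fun k => X k ω, abs_sub_comm]
    ring_nf
  · have h1 : ∫ ω, g (X k ω) ∂μ = ∫ x, g x ∂(chainLaw P i) := by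
      rw [← hlaw k, integral_map (hX k).aemeasurable hg.aestronglyMeasurable]
    rw [h1]
    have h2 : g = fun x => 1 - {x : ℕ → S | (θ : ℕ∞) < returnTime i x}.indicator
        (fun _ => (1 : ℝ)) x := by
      funext x
      simp only [hgdef, Set.indicator_apply, Set.mem_ofPred_eq]
      split_ifs <;> simp
    rw [h2, integral_sub (integrable_const _) ((integrable_const _).indicator hms),
      integral_indicator_const _ hms]
    simp [returnTail]

end FixedSize

variable {X : ℕ → ℕ → Ω → (ℕ → S)} (hX : ∀ t k, Measurable (X t k))
  (hlaw : ∀ t k, μ.map (X t k) = chainLaw P i)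
  (hind : iIndepFun (fun tk : ℕ × ℕ => X tk.1 tk.2) μ)

/-- The σ-algebra generated by the samples of the iterations in `T`. -/
@[reducible] def sampleSigma (X : ℕ → ℕ → Ω → (ℕ → S)) (T : Set ℕ) : MeasurableSpace Ω :=
  ⨆ p ∈ {p : ℕ × ℕ | p.1 ∈ T}, MeasurableSpace.comap (X p.1 p.2) inferInstance

omit mΩ [Fintype S] [DecidableEq S] [MeasurableSingletonClass S] in
lemma measurable_sampleSigma {T : Set ℕ} {t : ℕ} (ht : t ∈ T) (k : ℕ) :
    Measurable[sampleSigma X T] (X t k) :=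
  Measurable.mono (comap_measurable (X t k))
    (le_iSup₂_of_le (f := fun (p : ℕ × ℕ) (_ : p ∈ {p : ℕ × ℕ | p.1 ∈ T}) =>
      MeasurableSpace.comap (X p.1 p.2) inferInstance) (t, k) ht le_rfl) le_rfl

include hX in
omit [Fintype S] [DecidableEq S] [MeasurableSingletonClass S] in
lemma sampleSigma_le (T : Set ℕ) : sampleSigma X T ≤ mΩ :=
  iSup₂_le fun p _ => (hX p.1 p.2).comap_le

include hX hind in
omit [Fintype S] [DecidableEq S] [MeasurableSingletonClass S] [IsProbabilityMeasure μ] in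
lemma indep_sampleSigma {T T' : Set ℕ} (h : Disjoint T T') :
    Indep (sampleSigma X T) (sampleSigma X T') μ :=
  indep_iSup_of_disjoint (m := fun p : ℕ × ℕ => MeasurableSpace.comap (X p.1 p.2) inferInstance)
    (fun p => (hX p.1 p.2).comap_le) hind
    (Set.disjoint_left.2 fun _ h1 h2 => Set.disjoint_left.1 h h1 h2)

include hX hlaw hind

/-- The hypothesis on `G` makes the Chernoff exponent at least `log (4θ/α)`, so the failure bound is
`2 · α/(4θ)`. `G` must belong to the past of iteration `t` to be independent of its samples. -/
lemma measure_inter_THat_bad_le (hε0 : 0 < ε) (hε1 : ε < 1) (hα0 : 0 < α) (hα1 : α < 1)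
    {t : ℕ} (ht : 1 ≤ t) {G : Set Ω} (hG : MeasurableSet[sampleSigma X (Set.Iio t)] G)
    (hN : ∀ ω ∈ G, 3 * (threshold t : ℝ) * Real.log (4 * (threshold t : ℝ) / α) ≤
      ε ^ 2 * numSamples ε α i (fun s k => X s k ω) t * truncMean P i (threshold t)) :
    μ (G ∩ {ω | ε * truncMean P i (threshold t) <
        |THat ε α i (fun s k => X s k ω) t - truncMean P i (threshold t)|}) ≤
      ENNReal.ofReal (α / (2 * threshold t)) := by
  have hθ : (0 : ℝ) < threshold t := by exact_mod_cast threshold_pos t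
  refine measure_inter_random_index_le (m₁ := sampleSigma X (Set.Iio t))
    (m₂ := sampleSigma X {t}) (N := fun ω => numSamples ε α i (fun s k => X s k ω) t)
    (F := fun n => {ω | ε * truncMean P i (threshold t) <
      |meanTruncTime i (threshold t) n (fun k => X t k ω) - truncMean P i (threshold t)|})
    (indep_sampleSigma hX hind (by simp)) ?_ hG (sampleSigma_le hX _) ?_ ?_
  -- Measurability is needed for the σ-algebra of the past, not the ambient one, so the instance is
  -- explicit.
  · exact @measurable_numSamples S _ _ Ω (sampleSigma X (Set.Iio t)) ε α i X t
      fun s hs k => measurable_sampleSigma (Set.mem_Iio.2 hs) k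
  · intro n
    have := @measurable_meanTruncTime S _ _ Ω (sampleSigma X {t}) i (threshold t) n (X t)
      fun k => measurable_sampleSigma (Set.mem_singleton t) k
    exact @measurableSet_lt_abs_sub Ω (sampleSigma X {t}) _ this _ _
  · intro ω hω
    set n := numSamples ε α i (fun s k => X s k ω) t
    have h := meanTruncTime_concentration P i (hX t) (hlaw t)
      (hind.precomp (g := fun k => (t, k)) fun a b hab => (Prod.mk.inj hab).2) hε0 hε1
      (threshold_pos t) (numSamples_pos hε0 hα0 hα1 i (fun s k => X s k ω) ht)
    rw [← ofReal_measureReal]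
    refine ENNReal.ofReal_le_ofReal (h.trans ?_)
    have h1 : Real.log (4 * (threshold t : ℝ) / α) ≤
        ε ^ 2 * (n * truncMean P i (threshold t)) / (3 * threshold t) := by
      rw [le_div_iff₀ (by positivity)]
      linarith [hN ω hω]
    refine (mul_le_mul_of_nonneg_left (Real.exp_le_exp.2 (neg_le_neg h1)) zero_le_two).trans ?_
    rw [Real.exp_neg, Real.exp_log (by positivity)]
    refine le_of_eq ?_
    field_simp
    norm_num

lemma measure_pHat_bad_le (hε0 : 0 < ε) (hε1 : ε < 1) (hα0 : 0 < α) (hα1 : α < 1)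
    {t : ℕ} (ht : 1 ≤ t) (hp : returnTail P i (threshold t) < 1 / 2) :
    μ {ω | ε * (1 - returnTail P i (threshold t)) <
        |pHat ε α i (fun s k => X s k ω) t - returnTail P i (threshold t)|} ≤
      ENNReal.ofReal (Real.exp (-ε) * (α / (2 * threshold t))) := by
  have hθ : (0 : ℝ) < threshold t := by exact_mod_cast threshold_pos t
  have h := measure_inter_random_index_le (m₁ := sampleSigma X (Set.Iio t)) (μ := μ)
    (m₂ := sampleSigma X {t}) (N := fun ω => numSamples ε α i (fun s k => X s k ω) t)
    (F := fun n => {ω | ε * (1 - returnTail P i (threshold t)) <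
      |truncFraction i (threshold t) n (fun k => X t k ω) - returnTail P i (threshold t)|})
    (c := ENNReal.ofReal (Real.exp (-ε) * (α / (2 * threshold t))))
    (indep_sampleSigma hX hind (by simp)) ?_ MeasurableSet.univ (sampleSigma_le hX _) ?_ ?_
  · rw [Set.univ_inter] at h
    exact h
  · exact @measurable_numSamples S _ _ Ω (sampleSigma X (Set.Iio t)) ε α i X t
      fun s hs k => measurable_sampleSigma (Set.mem_Iio.2 hs) k
  · intro n
    have := @measurable_truncFraction S _ _ Ω (sampleSigma X {t}) i (threshold t) n (X t)
      fun k => measurable_sampleSigma (Set.mem_singleton t) k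
    exact @measurableSet_lt_abs_sub Ω (sampleSigma X {t}) _ this _ _
  · intro ω _
    set n := numSamples ε α i (fun s k => X s k ω) t with hn
    have h := truncFraction_concentration P i (hX t) (hlaw t)
      (hind.precomp (g := fun k => (t, k)) fun a b hab => (Prod.mk.inj hab).2) hε0 hε1
      (θ := threshold t) (numSamples_pos hε0 hα0 hα1 i (fun s k => X s k ω) ht)
    rw [← ofReal_measureReal]
    refine ENNReal.ofReal_le_ofReal (h.trans ?_)
    have hl := one_le_log_threshold hα0 hα1 ht
    set L := Real.log (4 * (threshold t : ℝ) / α) with hL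
    have h0 := log_le_mul_numSamples hε0 hα0 hα1 i (fun s k => X s k ω) ht
    rw [← hn, ← hL] at h0
    -- Since `1 - p > 1/2`, the exponent is at least `(1 + ε) L ≥ L + ε`.
    have h1 : L + ε ≤ ε ^ 2 * (n * (1 - returnTail P i (threshold t))) / 3 := by
      have h2 := mul_le_mul_of_nonneg_right h0
        (show 0 ≤ 1 - returnTail P i (threshold t) by linarith)
      have h3 : (L + ε) * 3 ≤ 6 * (1 + ε) * L * (1 / 2) := by nlinarith
      have h4 : 6 * (1 + ε) * L * (1 / 2) ≤
          6 * (1 + ε) * L * (1 - returnTail P i (threshold t)) :=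
        mul_le_mul_of_nonneg_left (by linarith) (by positivity)
      rw [le_div_iff₀ (by positivity)]
      linarith
    refine (mul_le_mul_of_nonneg_left (Real.exp_le_exp.2 (neg_le_neg h1)) zero_le_two).trans ?_
    rw [neg_add, Real.exp_add, Real.exp_neg L, hL, Real.exp_log (by positivity)]
    refine le_of_eq ?_
    field_simp
    norm_num

/-- With probability more than `1 - α`, the estimates of all iterations are accurate. -/
lemma exists_bad_set (hε0 : 0 < ε) (hε1 : ε < 1) (hα0 : 0 < α) (hα1 : α < 1) :
    ∃ B : Set Ω, μ B < ENNReal.ofReal α ∧ ∀ ω ∉ B, ∀ t, 1 ≤ t →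
      |THat ε α i (fun s k => X s k ω) t - truncMean P i (threshold t)| ≤
        ε * truncMean P i (threshold t) ∧
      (returnTail P i (threshold t) < 1 / 2 →
        |pHat ε α i (fun s k => X s k ω) t - returnTail P i (threshold t)| ≤
          ε * (1 - returnTail P i (threshold t))) := by
  set BT : ℕ → Set Ω := fun t => {ω | ε * truncMean P i (threshold t) <
        |THat ε α i (fun s k => X s k ω) t - truncMean P i (threshold t)|} with hBT
  set BP : ℕ → Set Ω := fun t => {ω | returnTail P i (threshold t) < 1 / 2 ∧
    ε * (1 - returnTail P i (threshold t)) <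
        |pHat ε α i (fun s k => X s k ω) t - returnTail P i (threshold t)|} with hBP
  -- `G t` says that the iteration before `t + 1` was accurate; it is everything at 0, as iteration
  -- 1 has no predecessor.
  set G : ℕ → Set Ω := fun t => if t = 0 then Set.univ else (BT t)ᶜ with hGd
  have hBTm : ∀ t, MeasurableSet[sampleSigma X (Set.Iio (t + 1))] (BT t) := by
    intro t
    have := @measurable_THat S _ _ Ω (sampleSigma X (Set.Iio (t + 1))) ε α i X t
      fun s hs k => measurable_sampleSigma (Set.mem_Iio.2 (Nat.lt_succ_of_le hs)) k
    exact @measurableSet_lt_abs_sub Ω (sampleSigma X (Set.Iio (t + 1))) _ this _ _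
  have hGm : ∀ t, MeasurableSet[sampleSigma X (Set.Iio (t + 1))] (G t) := by
    intro t
    simp only [hGd]
    split_ifs
    exacts [MeasurableSet.univ, (hBTm t).compl]
  have hT : ∀ t, μ (G t ∩ BT (t + 1)) ≤ ENNReal.ofReal (α / (2 * threshold (t + 1))) := by
    intro t
    refine measure_inter_THat_bad_le P i hX hlaw hind hε0 hε1 hα0 hα1 (Nat.le_add_left 1 t)
      (hGm t) fun ω hω => ?_
    have hl := one_le_log_threshold hα0 hα1 (Nat.le_add_left 1 t)
    have hθ : (0 : ℝ) < threshold (t + 1) := by exact_mod_cast threshold_pos (t + 1)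
    have hτ := one_le_truncMean P i (threshold_pos (t + 1))
    rcases Nat.eq_zero_or_pos t with rfl | ht
    · have h := log_le_mul_numSamples hε0 hα0 hα1 i (fun s k => X s k ω) (le_refl 1)
      have h2 : (threshold (0 + 1) : ℝ) = 2 := by simp [threshold]
      rw [h2] at hl ⊢
      have h3 : (threshold 1 : ℝ) = 2 := by simp [threshold]
      rw [h3] at h
      refine le_trans ?_ (le_mul_of_one_le_right (by positivity) hτ)
      refine le_trans ?_ h
      nlinarith
    · have hω' : ω ∉ BT t := by
        simp only [hGd, if_neg ht.ne'] at hω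
        exact hω
      have h1 : THat ε α i (fun s k => X s k ω) t ≤
          (1 + ε) * truncMean P i (threshold (t + 1)) := by
        have hω'' : |THat ε α i (fun s k => X s k ω) t - truncMean P i (threshold t)| ≤
            ε * truncMean P i (threshold t) := not_lt.1 hω'
        have h2 := (abs_le.1 hω'').2
        have h3 : truncMean P i (threshold t) ≤ truncMean P i (threshold (t + 1)) :=
          truncMean_mono P i (Nat.pow_le_pow_right two_pos (Nat.le_succ t))
        nlinarith
      have h := mul_log_le_mul_numSamples hε0 hα0 hα1 i (fun s k => X s k ω) ht h1
      refine le_of_mul_le_mul_right ?_ (show 0 < 1 + ε by linarith)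
      linarith
  have hPm : ∀ t, μ (BP (t + 1)) ≤
      ENNReal.ofReal (Real.exp (-ε) * (α / (2 * threshold (t + 1)))) := by
    intro t
    by_cases hp : returnTail P i (threshold (t + 1)) < 1 / 2
    · refine (measure_mono fun ω hω => ?_).trans
        (measure_pHat_bad_le P i hX hlaw hind hε0 hε1 hα0 hα1 (Nat.le_add_left 1 t) hp)
      exact hω.2
    · have : BP (t + 1) = ∅ := by
        ext ω
        simp only [hBP, Set.mem_ofPred_eq, Set.mem_empty_iff_false, iff_false]
        exact fun h => hp h.1
      rw [this, measure_empty]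
      exact zero_le
  -- Failures of `T̂` are counted only after a success. This loses nothing: outside the union,
  -- induction on `t` excludes every failure.
  refine ⟨⋃ t, (G t ∩ BT (t + 1)) ∪ BP (t + 1), ?_, ?_⟩
  · have hr : Real.exp (-ε) < 1 := by
      rw [Real.exp_lt_one_iff]; linarith
    have hr0 := Real.exp_pos (-ε)
    set r := Real.exp (-ε)
    calc _ ≤ ∑' t, μ ((G t ∩ BT (t + 1)) ∪ BP (t + 1)) := measure_iUnion_le _
      _ ≤ ∑' t : ℕ, ENNReal.ofReal ((1 + r) * (α / 4) * (1 / 2) ^ t) := by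
          refine ENNReal.tsum_le_tsum fun t => (measure_union_le _ _).trans ?_
          refine (add_le_add (hT t) (hPm t)).trans (le_of_eq ?_)
          rw [← ENNReal.ofReal_add (by positivity) (by positivity), cast_threshold]
          congr 1
          rw [pow_succ, one_div, inv_pow]
          field_simp
          ring
      _ = ENNReal.ofReal ((1 + r) * (α / 4) * 2) := by
          rw [← ENNReal.ofReal_tsum_of_nonneg (fun t => by positivity)
            (summable_geometric_two.mul_left _), tsum_mul_left, tsum_geometric_two]
      _ < ENNReal.ofReal α := by
          rw [ENNReal.ofReal_lt_ofReal_iff hα0]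
          nlinarith
  · intro ω hω
    have hω' : ∀ t, ω ∉ (G t ∩ BT (t + 1)) ∪ BP (t + 1) := fun t h =>
      hω (Set.mem_iUnion.2 ⟨t, h⟩)
    have hTn : ∀ t, ω ∉ BT (t + 1) := by
      intro t
      induction t with
      | zero =>
        intro h
        exact hω' 0 (Or.inl ⟨by simp [hGd], h⟩)
      | succ t ih =>
        intro h
        refine hω' (t + 1) (Or.inl ⟨?_, h⟩)
        simp only [hGd, if_neg (Nat.succ_ne_zero t)]
        exact ih
    intro t ht
    obtain ⟨s, rfl⟩ := Nat.exists_eq_add_of_le' ht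
    refine ⟨not_lt.1 (hTn s), fun hp => not_lt.1 fun h => hω' s (Or.inr ⟨hp, h⟩)⟩

end Concentration

/-! ### From accurate estimates to the relative error. -/

/-- Relative error of the quotient of two estimates, in terms of their relative errors `ε` and of
the bias of the quotient of the estimated quantities. -/
lemma relative_error_le {ε p p' T τ r M : ℝ} (hε0 : 0 < ε) (hε1 : ε < 1) (hp : p < 1)
    (hτ : 0 < τ) (hT : |T - τ| ≤ ε * τ) (hp' : |p' - p| ≤ ε * (1 - p))
    (hbias : |(1 - p) - r * τ| ≤ p * M) :
    0 < (1 - p') / T ∧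
      |((1 - p') / T - r) / ((1 - p') / T)| ≤
        ((1 + ε) / (1 - ε)) * (p / (1 - p)) * M + 2 * ε / (1 - ε) := by
  obtain ⟨hT1, hT2⟩ := abs_le.1 hT
  obtain ⟨hp1, hp2⟩ := abs_le.1 hp'
  have hq : 0 < 1 - p := by linarith
  have he : 0 < 1 - ε := by linarith
  have hT0 : 0 < T := by nlinarith
  have ha0 : 0 < 1 - p' := by nlinarith
  refine ⟨div_pos ha0 hT0, ?_⟩
  generalize ha : 1 - p' = a at *
  have ha1 : (1 - ε) * (1 - p) ≤ a := by linarith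
  have ha2 : a ≤ (1 + ε) * (1 - p) := by linarith
  -- `u` is the ratio of the ideal quotient `(1 - p)/τ` to the estimate `a/T`; it splits the error
  -- into `u` times the relative bias plus `1 - u`.
  set u := T * (1 - p) / (a * τ) with hu
  have hu0 : 0 ≤ u := by positivity
  have hu1 : u ≤ (1 + ε) / (1 - ε) := by
    rw [hu, div_le_div_iff₀ (by positivity) he]
    have h1 : T * ((1 - ε) * (1 - p)) ≤ ((1 + ε) * τ) * a :=
      mul_le_mul (by linarith) ha1 (by positivity) (by positivity)
    linarith
  have hu2 : (1 - ε) / (1 + ε) ≤ u := by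
    rw [hu, div_le_div_iff₀ (by positivity) (by positivity)]
    have h1 : ((1 - ε) * τ) * a ≤ T * ((1 + ε) * (1 - p)) :=
      mul_le_mul (by linarith) ha2 ha0.le hT0.le
    linarith
  have hu3 : |1 - u| ≤ 2 * ε / (1 - ε) := by
    rw [abs_le]
    constructor
    · have : 1 + 2 * ε / (1 - ε) = (1 + ε) / (1 - ε) := by field_simp; ring
      linarith
    · have h1 : 1 - (1 - ε) / (1 + ε) = 2 * ε / (1 + ε) := by field_simp; ring
      have h2 : 2 * ε / (1 + ε) ≤ 2 * ε / (1 - ε) := by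
        gcongr
        linarith
      linarith
  have hdec : (a / T - r) / (a / T) = u * (((1 - p) - r * τ) / (1 - p)) + (1 - u) := by
    rw [hu]
    field_simp
    ring
  rw [hdec]
  refine (abs_add_le _ _).trans (add_le_add ?_ hu3)
  rw [abs_mul, abs_of_nonneg hu0, abs_div, abs_of_pos hq, mul_assoc]
  refine mul_le_mul hu1 ?_ (by positivity) (by positivity)
  rw [div_mul_eq_mul_div]
  gcongr

end ReturnTimeMC

end

/-! ### Assembly of the bias and sampling bounds. -/

theorem mainTheorem4
    {S : Type*} [Fintype S] [DecidableEq S] [MeasurableSpace S] [MeasurableSingletonClass S]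
    (P : Matrix.rowStochastic ℝ S) (hP : (P : Matrix S S ℝ).IsIrreducible)
    (π : S → ℝ) (hπ : ReturnTimeMC.IsStationary (P : Matrix S S ℝ) π)
    (i : S) (ε α : ℝ) (hε0 : 0 < ε) (hε1 : ε < 1) (hα0 : 0 < α) (hα1 : α < 1)
    {Ω : Type*} [MeasurableSpace Ω] (μ : Measure Ω) [IsProbabilityMeasure μ]
    (X : ℕ → ℕ → Ω → (ℕ → S))
    (hlaw : ∀ t k, HasLaw (X t k) (ReturnTimeMC.chainLaw P i) μ)
    (hindep : iIndepFun (fun tk : ℕ × ℕ => X tk.1 tk.2) μ) :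
    1 - α < μ.real {ω | ∀ t : ℕ, 1 ≤ t →
      ReturnTimeMC.returnTail P i (ReturnTimeMC.threshold t) < 1 / 2 →
        0 < ReturnTimeMC.piTilde ε α i (fun t k => X t k ω) t ∧
        |(ReturnTimeMC.piTilde ε α i (fun t k => X t k ω) t - π i) /
            ReturnTimeMC.piTilde ε α i (fun t k => X t k ω) t| ≤
          ((1 + ε) / (1 - ε)) *
              (ReturnTimeMC.returnTail P i (ReturnTimeMC.threshold t) /
                (1 - ReturnTimeMC.returnTail P i (ReturnTimeMC.threshold t))) *
              max (2 * ReturnTimeMC.Zmax (P : Matrix S S ℝ) π i - 1) 1 +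
            2 * ε / (1 - ε) ∧
        ((1 + ε) / (1 - ε)) *
              (ReturnTimeMC.returnTail P i (ReturnTimeMC.threshold t) /
                (1 - ReturnTimeMC.returnTail P i (ReturnTimeMC.threshold t))) *
              max (2 * ReturnTimeMC.Zmax (P : Matrix S S ℝ) π i - 1) 1 +
            2 * ε / (1 - ε) ≤
          4 * (1 + ε) / (1 - ε) *
              (2 : ℝ) ^ (-((ReturnTimeMC.threshold t : ℝ) /
                (2 * ReturnTimeMC.maxHittingTime P i))) *
              max (2 * ReturnTimeMC.Zmax (P : Matrix S S ℝ) π i - 1) 1 +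
            2 * ε / (1 - ε)} := by
  have hε : 0 < 1 - ε := by linarith
  -- The samples are only a.e. measurable; measurable versions agree with them off the null set `N`.
  set X' : ℕ → ℕ → Ω → (ℕ → S) := fun t k => (hlaw t k).aemeasurable.mk (X t k) with hX'
  have hae : ∀ t k, X t k =ᵐ[μ] X' t k := fun t k => (hlaw t k).aemeasurable.ae_eq_mk
  obtain ⟨B, hB, hgood⟩ := ReturnTimeMC.exists_bad_set (μ := μ) (X := X') P i
    (fun t k => (hlaw t k).aemeasurable.measurable_mk)
    (fun t k => by rw [← Measure.map_congr (hae t k), (hlaw t k).map_eq])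
    (hindep.congr fun p => hae p.1 p.2) hε0 hε1 hα0 hα1
  have hnull : μ {ω | ¬ ∀ t k, X t k ω = X' t k ω} = 0 := by
    rw [← ae_iff, ae_all_iff]
    intro t
    rw [ae_all_iff]
    exact hae t
  set N := {ω | ¬ ∀ t k, X t k ω = X' t k ω}
  rw [sub_lt_comm]
  refine lt_of_le_of_lt ?_
    (show μ.real (B ∪ N) < α from ?_)
  swap
  · refine ENNReal.toReal_lt_of_lt_ofReal ?_
    refine (measure_union_le B N).trans_lt ?_
    rwa [hnull, add_zero]
  rw [sub_le_iff_le_add]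
  -- Subadditivity on a cover of the whole space avoids having to show that the good event is
  -- measurable.
  refine (probReal_univ (μ := μ)).symm.le.trans (le_trans (measureReal_mono fun ω _ => ?_) (measureReal_union_le _ _))
  by_cases hω : ω ∈ B ∪ N
  · exact Or.inl hω
  right
  have hωB : ω ∉ B := fun h => hω (Or.inl h)
  have hXX : (fun t k => X t k ω) = fun t k => X' t k ω := by
    funext t k
    exact not_not.1 (fun h : ¬ ∀ t k, X t k ω = X' t k ω => hω (Or.inr h)) t k
  intro t ht hp
  rw [hXX]
  obtain ⟨hT, hP'⟩ := hgood ω hωB t ht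
  have hτ := ReturnTimeMC.one_le_truncMean P i (ReturnTimeMC.threshold_pos t)
  have hbias := ReturnTimeMC.abs_bias_le P.2 hP hπ i (ReturnTimeMC.threshold t)
  rw [← ReturnTimeMC.returnTail_eq] at hbias
  obtain ⟨h1, h2⟩ := ReturnTimeMC.relative_error_le hε0 hε1 (by linarith)
    (zero_lt_one.trans_le hτ) hT (hP' hp) hbias
  refine ⟨h1, h2, add_le_add_left ?_ _⟩
  have hp0 : 0 ≤ ReturnTimeMC.returnTail P i (ReturnTimeMC.threshold t) := measureReal_nonneg
  have hM : 0 ≤ max (2 * ReturnTimeMC.Zmax (P : Matrix S S ℝ) π i - 1) 1 :=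
    zero_le_one.trans (le_max_right _ _)
  have htail := ReturnTimeMC.returnTail_le P hP i (ReturnTimeMC.threshold t)
  refine mul_le_mul_of_nonneg_right ?_ hM
  have hodds : ReturnTimeMC.returnTail P i (ReturnTimeMC.threshold t) /
      (1 - ReturnTimeMC.returnTail P i (ReturnTimeMC.threshold t)) ≤
      4 * (2 : ℝ) ^ (-((ReturnTimeMC.threshold t : ℝ) /
        (2 * ReturnTimeMC.maxHittingTime P i))) := by
    -- As `p < 1/2`, the odds are at most `2p`, and `p` is at most twice the power of 2.
    rw [div_le_iff₀ (by linarith)]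
    nlinarith
  calc _ ≤ (1 + ε) / (1 - ε) * (4 * (2 : ℝ) ^ (-((ReturnTimeMC.threshold t : ℝ) /
        (2 * ReturnTimeMC.maxHittingTime P i)))) :=
        mul_le_mul_of_nonneg_left hodds (by positivity)
    _ = _ := by ring
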